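/- **Setting.** Let $\mathcal A$ be a set of actions with a distinguished internal action $\tau\in\mathcal A$. For a set $X$, $\mathit{Distr}(X)$ is the set of finitely supported probability distributions on $X$; $\delta(x)$ is the Dirac distribution on $x$; $\bigoplus_{i\in I}p_i\mu_i$ (with $I$ finite, $p_i\ge 0$, $\sum_i p_i=1$) is the convex combination of the $\mu_i\in\mathit{Distr}(X)$; and $\mu\oplus_r\nu=r\mu\oplus(1-r)\nu$ for $0\le r\le 1$. The non-deterministic processes $E\in\mathcal E$ and the probabilistic processes $P\in\mathcal P$ are given by $$E ::= \mathbf 0\mid \alpha.P\mid E+E,\qquad P ::= \partial(E)\mid P\oplus_r P\qquad(\alpha\in\mathcal A,\ 0\le r\le 1).$$ The relation $\mapsto$ between $\mathcal P$ and $\mathit{Distr}(\mathcal E)$ is generated by: $\partial(E)\mapsto\delta(E)$; and if $P_1\mapsto\mu_1$ and $P_2\mapsto\mu_2$ then $P_1\oplus_rP_2\mapsto\mu_1\oplus_r\mu_2$. The transitions $E\xrightarrow{\alpha}\mu$ are generated by: $\alpha.P\xrightarrow{\alpha}\mu$ if $P\mapsto\mu$; and $E_1+E_2\xrightarrow{\alpha}\mu$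 if $E_1\xrightarrow{\alpha}\mu$ or $E_2\xrightarrow{\alpha}\mu$. On $\mathit{Distr}(\mathcal E)$ define: * $\mu\xrightarrow{\alpha}\mu'$ iff one can write $\mu=\bigoplus_{i\in I}p_i\,\delta(E_i)$ and $\mu'=\bigoplus_{i\in I}p_i\,\mu'_i$ with $I$ finite and $E_i\xrightarrow{\alpha}\mu'_i$ for all $i\in I$; * $\mu\xrightarrow{(\alpha)}\mu'$ iff $\mu\xrightarrow{\alpha}\mu'$; or $\alpha=\tau$ and $\mu'=\mu$; or $\alpha=\tau$ and $\mu=\mu_1\oplus_r\mu_2$, $\mu'=\mu_1'\oplus_r\mu_2$, $\mu_1\xrightarrow{\tau}\mu_1'$ for some $r\in(0,1)$ and some $\mu_1,\mu_1',\mu_2\in\mathit{Distr}(\mathcal E)$; * $\Rightarrow$ is the reflexive transitive closure of $\xrightarrow{(\tau)}$. A relation $\mathcal R\subseteq\mathit{Distr}(\mathcal E)\times\mathit{Distr}(\mathcal E)$ is *weakly decomposable* if it is symmetric and, whenever $\mu\,\mathcal R\,\nu$ and $\mu=\bigoplus_{i\in I}p_i\mu_i$ with $I$ finite, there are $\bar\nu$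 and $\nu_i$ ($i\in I$) with $\nu\Rightarrow\bar\nu$, $\mu\,\mathcal R\,\bar\nu$, $\bar\nu=\bigoplus_{i\in I}p_i\nu_i$, and $\mu_i\,\mathcal R\,\nu_i$ for all $i\in I$. It is a *branching probabilistic bisimulation relation* if it is weakly decomposable and, whenever $\mu\,\mathcal R\,\nu$ and $\mu\xrightarrow{\alpha}\mu'$, there are $\bar\nu,\nu'$ with $\nu\Rightarrow\bar\nu$, $\bar\nu\xrightarrow{(\alpha)}\nu'$, $\mu\,\mathcal R\,\bar\nu$ and $\mu'\,\mathcal R\,\nu'$. *Branching probabilistic bisimilarity*, written $\simeq$, is the largest such relation, i.e. the union of all of them. **Theorem (Cancellativity).** Let $\mu,\mu',\nu,\nu'\in\mathit{Distr}(\mathcal E)$ and $0<r\le 1$ be such that $\mu\oplus_r\nu\simeq\mu'\oplus_r\nu'$ and $\nu\simeq\nu'$. Then $\mu\simeq\mu'$. -/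

import Mathlib

namespace ProbProc

noncomputable section

open Convexity

/-- `Distr(X)`: the finitely supported probability distributions over `X`. -/
abbrev Distr (X : Type*) := StdSimplex ℝ X

/-- The Dirac distribution `δ(x)`. -/
def dirac {X : Type*} (x : X) : Distr X := StdSimplex.single x

/-- The finite convex combination `⨁_{i < n} p_i · μ_i`. The weights `p_i ≥ 0` with sum `1`
are bundled as `p`; zero weights are allowed. -/
def bigOplus {X : Type*} {n : ℕ} (p : Distr (Fin n)) (μ : Fin n → Distr X) : Distr X :=
  p.iConvexComb μ

/-- The probabilistic composition `μ ⊕_r ν = r μ ⊕ (1 - r) ν`, for `0 ≤ r ≤ 1`. -/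
def oplus {X : Type*} (r : unitInterval) (μ ν : Distr X) : Distr X :=
  convexCombPair (r : ℝ) (1 - r) r.2.1 (sub_nonneg.2 r.2.2) (add_sub_cancel _ _) μ ν

theorem oplus_apply {X : Type*} (r : unitInterval) (μ ν : Distr X) (x : X) :
    (oplus r μ ν).weights x = r * μ.weights x + (1 - r) * ν.weights x := by
  simp [oplus]

theorem bigOplus_apply {X : Type*} {n : ℕ} (p : Distr (Fin n)) (μ : Fin n → Distr X) (x : X) :
    (bigOplus p μ).weights x = ∑ i, p.weights i * (μ i).weights x := by
  simp [bigOplus, StdSimplex.iConvexComb, Finsupp.sum_mapDomain_index, add_smul,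
    Finsupp.sum_fintype]

universe u

mutual
/-- The non-deterministic processes `E ::= 0 | α . P | E + E` over the set of actions `A`. -/
inductive NProc (A : Type u) : Type u
  | nil : NProc A
  | pref (a : A) (P : PProc A) : NProc A
  | choice (E F : NProc A) : NProc A
/-- The probabilistic processes `P ::= ∂(E) | P ⊕_r P` with `0 ≤ r ≤ 1`. -/
inductive PProc (A : Type u) : Type u
  | dirac (E : NProc A) : PProc A
  | pchoice (r : unitInterval) (P Q : PProc A) : PProc A
end

variable {A : Type u}

/-- The relation `P ↦ μ` between probabilistic processes and distributions. -/
inductive Denotes : PProc A → Distr (NProc A) → Prop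
  | dirac (E : NProc A) : Denotes (PProc.dirac E) (dirac E)
  | pchoice {P Q : PProc A} {μ ν : Distr (NProc A)} (r : unitInterval) :
      Denotes P μ → Denotes Q ν → Denotes (PProc.pchoice r P Q) (oplus r μ ν)

/-- The transition relation `E -α→ μ` on non-deterministic processes. -/
inductive NStep : NProc A → A → Distr (NProc A) → Prop
  | pref {a : A} {P : PProc A} {μ : Distr (NProc A)} :
      Denotes P μ → NStep (NProc.pref a P) a μ
  | choice_left {E F : NProc A} {a : A} {μ : Distr (NProc A)} :
      NStep E a μ → NStep (NProc.choice E F) a μ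
  | choice_right {E F : NProc A} {a : A} {μ : Distr (NProc A)} :
      NStep F a μ → NStep (NProc.choice E F) a μ

/-- The (combined) transition relation `μ -α→ μ'` on distributions. -/
def DStep (μ : Distr (NProc A)) (a : A) (μ' : Distr (NProc A)) : Prop :=
  ∃ (n : ℕ) (p : Distr (Fin n)) (E : Fin n → NProc A) (η : Fin n → Distr (NProc A)),
    μ = bigOplus p (fun i => dirac (E i)) ∧ μ' = bigOplus p η ∧ ∀ i, NStep (E i) a (η i)

/-- The relation `μ -(α)→ μ'`, where `τ` is the internal action. For `α = τ` it allows any part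
of the distribution to stay put. -/
def PartialStep (τ : A) (μ : Distr (NProc A)) (a : A) (μ' : Distr (NProc A)) : Prop :=
  DStep μ a μ' ∨
  (a = τ ∧ μ' = μ) ∨
  (a = τ ∧ ∃ (r : unitInterval) (μ₁ μ₂ μ₁' μ₂' : Distr (NProc A)), 0 < r ∧ r < 1 ∧
    μ = oplus r μ₁ μ₂ ∧ μ' = oplus r μ₁' μ₂' ∧ DStep μ₁ τ μ₁' ∧ μ₂ = μ₂')

/-- Weak transitions `μ ⇒ μ'`: the reflexive transitive closure of `-(τ)→`. -/
def WeakStep (τ : A) : Distr (NProc A) → Distr (NProc A) → Prop :=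
  Relation.ReflTransGen (fun μ μ' => PartialStep τ μ τ μ')

/-- Weakly decomposable relations on distributions. -/
def WeaklyDecomposable (τ : A) (R : Distr (NProc A) → Distr (NProc A) → Prop) : Prop :=
  (∀ μ ν, R μ ν → R ν μ) ∧
  ∀ μ ν, R μ ν → ∀ (n : ℕ) (p : Distr (Fin n)) (μs : Fin n → Distr (NProc A)),
    μ = bigOplus p μs →
    ∃ (ν' : Distr (NProc A)) (νs : Fin n → Distr (NProc A)),
      WeakStep τ ν ν' ∧ R μ ν' ∧ ν' = bigOplus p νs ∧ ∀ i, R (μs i) (νs i)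

/-- Branching probabilistic bisimulation relations on distributions. -/
def IsBranchingBisimulation (τ : A) (R : Distr (NProc A) → Distr (NProc A) → Prop) : Prop :=
  WeaklyDecomposable τ R ∧
  ∀ μ ν, R μ ν → ∀ (a : A) (μ' : Distr (NProc A)), DStep μ a μ' →
    ∃ ν₁ ν' : Distr (NProc A),
      WeakStep τ ν ν₁ ∧ PartialStep τ ν₁ a ν' ∧ R μ ν₁ ∧ R μ' ν'

/-- Branching probabilistic bisimilarity on distributions: the union of all branching
probabilistic bisimulation relations. -/
def Bisimilar (τ : A) (μ ν : Distr (NProc A)) : Prop :=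
  ∃ R : Distr (NProc A) → Distr (NProc A) → Prop, IsBranchingBisimulation τ R ∧ R μ ν

/-- Bisimilarity is itself a branching probabilistic bisimulation relation, hence the largest. -/
theorem bisimilar_isBranchingBisimulation (τ : A) :
    IsBranchingBisimulation τ (Bisimilar τ) := by
  refine ⟨⟨?_, ?_⟩, ?_⟩
  · rintro μ ν ⟨R, hR, h⟩
    exact ⟨R, hR, hR.1.1 _ _ h⟩
  · rintro μ ν ⟨R, hR, h⟩ n p μs hμ
    obtain ⟨ν', νs, h1, h2, h3, h4⟩ := hR.1.2 _ _ h n p μs hμ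
    exact ⟨ν', νs, h1, ⟨R, hR, h2⟩, h3, fun i => ⟨R, hR, h4 i⟩⟩
  · rintro μ ν ⟨R, hR, h⟩ a μ' hs
    obtain ⟨ν₁, ν', h1, h2, h3, h4⟩ := hR.2 _ _ h a μ' hs
    exact ⟨ν₁, ν', h1, h2, ⟨R, hR, h3⟩, ⟨R, hR, h4⟩⟩

end

end ProbProc

-- Call a distribution stable if no internal computation leads from it to a different bisimilar
-- distribution. Between stable distributions, bisimilarity amounts to equality of the induced
-- distributions over bisimilarity classes of processes (`classDistr_eq`,
-- `bisimilar_of_classDistr_eq`). Class distributions are real-valued functions that turn `⊕_r` into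
-- a convex combination, so the common part can be subtracted and the factor `r ≠ 0` cancelled. It
-- remains to replace each of the four distributions by a bisimilar stable one (`exists_stable`).
--
-- This replacement rests on two facts. Transitions strictly decrease the size of processes, so a
-- nontrivial weak move strictly decreases the expected size (`weakStep_eq_or_weight_lt`), and a
-- bisimilar weak derivative of minimal expected size is stable. The minimum exists by compactness:
-- all derivatives live on one finite set of processes, and both weak transitions (`weakStep_uLim`)
-- and bisimilarity (`bisimilar_uLim`) survive limits there. For bisimilarity this is proved by
-- showing that its closure under limits is again a branching bisimulation.
--
-- Throughout, bisimilarity must be an equivalence (`Bisimilar.trans`) and a congruence for convex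
-- combinations (`bisimilar_mix`); the latter needs a common refinement of two decompositions of one
-- distribution.

namespace ProbProc

noncomputable section

open Convexity Filter Topology

universe u

-- Convex combinations, kernels and disintegration

section Kit

variable {I J L X Y : Type*}

/-- The convex combination of a family of distributions over an arbitrary index type. -/
def mix (p : Distr I) (f : I → Distr X) : Distr X := p.iConvexComb f

theorem bigOplus_eq_mix {n : ℕ} (p : Distr (Fin n)) (f : Fin n → Distr X) :
    bigOplus p f = mix p f := rfl

theorem mix_apply_of_subset (p : Distr I) (f : I → Distr X) (x : X) {s : Finset I}
    (hs : ∀ i, p.weights i ≠ 0 → i ∈ s) :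
    (mix p f).weights x = ∑ i ∈ s, p.weights i * (f i).weights x := by
  have : (mix p f).weights x = p.weights.sum fun i r => r * (f i).weights x := by
    simp [mix, StdSimplex.iConvexComb, Finsupp.sum_mapDomain_index, add_smul]
  rw [this]
  exact Finsupp.sum_of_support_subset _ (fun i hi => hs i (by simpa using hi)) _ (by simp)

theorem mix_apply (p : Distr I) (f : I → Distr X) (x : X) :
    (mix p f).weights x = ∑ i ∈ p.weights.support, p.weights i * (f i).weights x :=
  mix_apply_of_subset p f x (by simp)

theorem distr_ext {μ ν : Distr X} (h : ∀ x, μ.weights x = ν.weights x) : μ = ν := by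
  ext x; exact h x

theorem weights_pos {μ : Distr X} {x : X} (h : μ.weights x ≠ 0) : 0 < μ.weights x :=
  lt_of_le_of_ne (μ.nonneg x) h.symm

theorem sum_weights_of_subset (p : Distr I) {s : Finset I} (hs : ∀ i, p.weights i ≠ 0 → i ∈ s) :
    ∑ i ∈ s, p.weights i = 1 := by
  rw [← p.total]
  exact (Finsupp.sum_of_support_subset _ (fun i hi => hs i (by simpa using hi))
    (fun _ r => r) (fun _ _ => rfl)).symm

theorem weights_le_one (p : Distr I) (i : I) : p.weights i ≤ 1 := by
  classical
  rw [← sum_weights_of_subset p (s := insert i p.weights.support)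
    (fun j hj => Finset.mem_insert_of_mem (Finsupp.mem_support_iff.2 hj))]
  exact Finset.single_le_sum (f := fun i => p.weights i) (fun j _ => p.nonneg j) (by simp)

theorem exists_weights_ne_zero (p : Distr I) : ∃ i, p.weights i ≠ 0 := by
  obtain ⟨i, hi⟩ := p.support_weights_nonempty
  exact ⟨i, by simpa using hi⟩

theorem mix_ne_zero {p : Distr I} {f : I → Distr X} {x : X} :
    (mix p f).weights x ≠ 0 ↔ ∃ i, p.weights i ≠ 0 ∧ (f i).weights x ≠ 0 := by
  rw [mix_apply, Ne, Finset.sum_eq_zero_iff_of_nonneg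
    (fun i _ => mul_nonneg (p.nonneg i) ((f i).nonneg x))]
  simp

theorem mix_congr {p : Distr I} {f g : I → Distr X} (h : ∀ i, p.weights i ≠ 0 → f i = g i) :
    mix p f = mix p g := iConvexComb_congr h

theorem mix_mix (p : Distr I) (f : I → Distr J) (g : J → Distr X) :
    mix (mix p f) g = mix p (fun i => mix (f i) g) := (iConvexComb_assoc p f g).symm

theorem mix_map (p : Distr I) (f : I → J) (g : J → Distr X) :
    mix (p.map f) g = mix p (fun i => g (f i)) := iConvexComb_map p f g

theorem map_mix (p : Distr I) (f : I → Distr X) (g : X → Y) :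
    (mix p f).map g = mix p (fun i => (f i).map g) := map_iConvexComb p f

theorem mix_const (p : Distr I) (μ : Distr X) : mix p (fun _ => μ) = μ := iConvexComb_const p μ

theorem mix_dirac_left (i : I) (f : I → Distr X) : mix (dirac i) f = f i := iConvexComb_single i f

theorem map_const (p : Distr I) (x : X) : p.map (fun _ => x) = dirac x :=
  StdSimplex.map_const p x

theorem dirac_apply [DecidableEq X] (x y : X) : (dirac x).weights y = if x = y then 1 else 0 := by
  simp [dirac, Finsupp.single_apply]

theorem dirac_ne_zero {x y : X} : (dirac x).weights y ≠ 0 ↔ y = x := by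
  classical
  rw [dirac_apply]; simp [eq_comm]

theorem mix_dirac_comp (p : Distr I) (f : I → X) : mix p (fun i => dirac (f i)) = p.map f := by
  have : (dirac : X → Distr X) = StdSimplex.single := rfl
  ext x
  simp only [mix, StdSimplex.iConvexComb, StdSimplex.weights_sConvexComb]
  rw [StdSimplex.weights_map, Finsupp.sum_mapDomain_index (by simp) (by simp [add_smul])]
  simp [this, Finsupp.mapDomain]

theorem mix_dirac (p : Distr X) : mix p dirac = p := by
  have := mix_dirac_comp p id
  simpa using this

theorem map_ne_zero {p : Distr I} {f : I → X} {x : X} :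
    (p.map f).weights x ≠ 0 ↔ ∃ i, p.weights i ≠ 0 ∧ f i = x := by
  rw [← mix_dirac_comp, mix_ne_zero]
  simp only [dirac_ne_zero, eq_comm]

theorem eq_dirac_of_support {μ : Distr X} {x : X} (h : ∀ y, μ.weights y ≠ 0 → y = x) :
    μ = dirac x := by
  rw [← mix_dirac μ, mix_congr (g := fun _ => dirac x) (fun y hy => by rw [h y hy]), mix_const]

/-- A mixture that is a Dirac distribution has only that distribution as components. -/
theorem eq_dirac_of_mix_eq_dirac {p : Distr I} {f : I → Distr X} {x : X}
    (h : mix p f = dirac x) {i : I} (hi : p.weights i ≠ 0) : f i = dirac x :=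
  eq_dirac_of_support fun y hy => by
    have := mix_ne_zero.2 ⟨i, hi, hy⟩
    rwa [h, dirac_ne_zero] at this

/-- The joint distribution of a distribution and a kernel. -/
def joint (p : Distr I) (k : I → Distr J) : Distr (I × J) :=
  mix p (fun i => (k i).map (Prod.mk i))

theorem joint_apply (p : Distr I) (k : I → Distr J) (i : I) (j : J) :
    (joint p k).weights (i, j) = p.weights i * (k i).weights j := by
  classical
  rw [joint, mix_apply_of_subset p _ _ (s := insert i p.weights.support) (by simp +contextual),
    Finset.sum_eq_single_of_mem i (by simp)]
  · congr 1
    simp only [StdSimplex.weights_map]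
    exact Finsupp.mapDomain_apply (Prod.mk_right_injective i) _ _
  · intro l _ hl
    have : ((k l).map (Prod.mk l)).weights (i, j) = 0 := by
      by_contra h
      obtain ⟨b, -, hb⟩ := map_ne_zero.1 h
      exact hl (congrArg Prod.fst hb)
    rw [this, mul_zero]

theorem joint_ne_zero {p : Distr I} {k : I → Distr J} {e : I × J} :
    (joint p k).weights e ≠ 0 ↔ p.weights e.1 ≠ 0 ∧ (k e.1).weights e.2 ≠ 0 := by
  rw [← Prod.mk.eta (p := e), joint_apply]; simp

theorem mix_joint (p : Distr I) (k : I → Distr J) (f : I × J → Distr X) :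
    mix (joint p k) f = mix p (fun i => mix (k i) (fun j => f (i, j))) := by
  simp only [joint, mix_mix, mix_map]

theorem map_joint (p : Distr I) (k : I → Distr J) (f : I × J → X) :
    (joint p k).map f = mix p (fun i => (k i).map (fun j => f (i, j))) := by
  simp only [joint, map_mix, StdSimplex.map_map]

theorem map_fst_joint (p : Distr I) (k : I → Distr J) : (joint p k).map Prod.fst = p := by
  rw [map_joint]
  simp only [StdSimplex.map_const]
  exact mix_dirac p

theorem map_snd_joint (p : Distr I) (k : I → Distr J) : (joint p k).map Prod.snd = mix p k := by
  rw [map_joint]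
  exact mix_congr fun i _ => StdSimplex.map_id (k i)

theorem joint_inj {p : Distr I} {k k' : I → Distr J} (h : joint p k = joint p k') {i : I}
    (hi : p.weights i ≠ 0) : k i = k' i := by
  apply distr_ext; intro j
  have := joint_apply p k i j
  rw [h, joint_apply] at this
  exact (mul_left_cancel₀ hi this).symm

/-- Disintegration of a joint distribution along its first marginal. -/
theorem exists_eq_joint (W : Distr (I × J)) : ∃ k : I → Distr J, W = joint (W.map Prod.fst) k := by
  classical
  have hne : ∀ i, (W.map Prod.fst).weights i ≠ 0 → ∃ e ∈ Prod.fst ⁻¹' {i}, W.weights e ≠ 0 := by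
    intro i hi
    obtain ⟨e, he, rfl⟩ := map_ne_zero.1 hi
    exact ⟨e, rfl, he⟩
  have hval : ∀ i, (W.map Prod.fst).weights i =
      (W.weights.filter (· ∈ Prod.fst ⁻¹' {i})).sum fun _ r => r := by
    intro i
    rw [StdSimplex.weights_map, Finsupp.mapDomain, Finsupp.sum_apply, Finsupp.sum, Finsupp.sum,
      Finsupp.support_filter, Finset.sum_filter]
    refine Finset.sum_congr rfl fun e _ => ?_
    by_cases h : e.1 = i <;> simp [h]
  -- Off the support of the marginal the kernel is irrelevant; the second marginal of `W` is a
  -- default value there.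
  refine ⟨fun i => if h : (W.map Prod.fst).weights i ≠ 0
    then (W.restrict (Prod.fst ⁻¹' {i}) (hne i h)).map Prod.snd else W.map Prod.snd, ?_⟩
  apply distr_ext
  rintro ⟨i, j⟩
  rw [joint_apply]
  by_cases h : (W.map Prod.fst).weights i ≠ 0
  · rw [dif_pos h]
    have h1 : ((W.restrict (Prod.fst ⁻¹' {i}) (hne i h)).map Prod.snd).weights j =
        (W.restrict (Prod.fst ⁻¹' {i}) (hne i h)).weights (i, j) := by
      set ρ := W.restrict (Prod.fst ⁻¹' {i}) (hne i h)
      have hρ : ∀ e, ρ.weights e ≠ 0 → e.1 = i := by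
        intro e he
        have : e ∈ ρ.weights.support := by simpa using he
        rw [StdSimplex.support_weights_restrict] at this
        simpa using (Finset.mem_filter.1 this).2
      have h2 : ρ.map Prod.snd = mix ρ (fun e => dirac e.2) := (mix_dirac_comp _ _).symm
      rw [h2, mix_apply_of_subset ρ _ _ (s := insert (i, j) ρ.weights.support)
        (by simp +contextual), Finset.sum_eq_single_of_mem (i, j) (by simp)]
      · simp [dirac_apply]
      · rintro ⟨a, b⟩ _ hab
        by_cases hz : ρ.weights (a, b) = 0
        · simp [hz]
        · have := hρ _ hz
          have hb : b ≠ j := by rintro rfl; exact hab (by simp at this; rw [this])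
          simp [dirac_apply, hb]
    rw [h1, StdSimplex.weights_restrict, Finsupp.smul_apply, ← hval i, smul_eq_mul,
      mul_inv_cancel_left₀ h]
    simp
  · have h0 : W.weights (i, j) = 0 := by
      by_contra h'
      exact h (map_ne_zero.2 ⟨(i, j), h', rfl⟩)
    push Not at h
    rw [h0, mul_eq_zero_of_left h]

/-- Disintegration of a joint distribution along its second marginal. -/
theorem exists_eq_joint_swap (W : Distr (I × J)) :
    ∃ k : J → Distr I, W = (joint (W.map Prod.snd) k).map Prod.swap := by
  obtain ⟨k, hk⟩ := exists_eq_joint (W.map Prod.swap)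
  refine ⟨k, ?_⟩
  rw [StdSimplex.map_map] at hk
  change W.map Prod.swap = joint (W.map Prod.snd) k at hk
  rw [← hk, StdSimplex.map_map]
  exact (StdSimplex.map_id W).symm

/-- Every distribution is the image of one on an initial segment of the naturals, along an
injection into its support. -/
theorem exists_enumeration (p : Distr I) : ∃ (n : ℕ) (q : Distr (Fin n)) (e : Fin n → I),
    q.map e = p ∧ Function.Injective e ∧ ∀ i, p.weights (e i) ≠ 0 := by
  classical
  let s := p.weights.support
  let e : Fin s.card ≃ s := s.equivFin.symm
  have hmem : ∀ i, p.weights (e i : I) ≠ 0 := fun i => Finsupp.mem_support_iff.1 (e i).2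
  refine ⟨s.card, ⟨Finsupp.equivFunOnFinite.symm fun i => p.weights (e i), fun i => p.nonneg _, ?_⟩,
    fun i => e i, ?_, fun i j h => e.injective (Subtype.ext h), hmem⟩
  · rw [Finsupp.sum_fintype _ _ (by simp)]
    simp only [Finsupp.equivFunOnFinite_symm_apply_apply]
    rw [Equiv.sum_comp e (fun i : s => p.weights i), Finset.sum_coe_sort s (fun i => p.weights i)]
    exact sum_weights_of_subset p (by simp [s])
  · rw [← mix_dirac_comp]
    apply distr_ext
    intro x
    rw [mix_apply_of_subset _ _ _ (s := Finset.univ) (by simp)]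
    simp only [Finsupp.equivFunOnFinite_symm_apply_apply]
    rw [Equiv.sum_comp e (fun i : s => p.weights i * (dirac (i : I)).weights x),
      Finset.sum_coe_sort s (fun i => p.weights i * (dirac i).weights x)]
    rw [← mix_apply_of_subset p dirac x (s := s) (by simp [s]), mix_dirac]

/-- The weights `p` are chosen before the type and the components, so several compositions `⊕_r` can
be rewritten as mixtures over the same `p`. -/
theorem oplus_eq_mix (r : unitInterval) :
    ∃ p : Distr (Fin 2), p.weights 0 = r ∧ p.weights 1 = 1 - r ∧
      ∀ (Y : Type _) (f : Fin 2 → Distr Y), oplus r (f 0) (f 1) = mix p f := by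
  let p : Distr (Fin 2) := StdSimplex.duple 0 1 r.2.1 (sub_nonneg.2 r.2.2) (add_sub_cancel _ _)
  have h0 : p.weights 0 = r := by simp [p]
  have h1 : p.weights 1 = 1 - r := by simp [p]
  refine ⟨p, h0, h1, fun Y f => distr_ext fun x => ?_⟩
  rw [oplus_apply, mix_apply_of_subset _ _ _ (s := Finset.univ) (by simp), Fin.sum_univ_two, h0, h1]

attribute [irreducible] mix

end Kit

-- Lifting point-to-distribution relations, and their iterates

section Lifting

variable {I X : Type*}

/-- The lifting to distributions of a relation between points and distributions: a distribution
moves by letting every point of its support move to a mixture of its successors. -/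
def Lift (S : X → Distr X → Prop) (μ μ' : Distr X) : Prop :=
  ∃ J : Distr (X × Distr X), (∀ e, J.weights e ≠ 0 → S e.1 e.2) ∧
    J.map Prod.fst = μ ∧ mix J Prod.snd = μ'

variable {S : X → Distr X → Prop}

theorem Lift.mono {T : X → Distr X → Prop} (h : ∀ x η, S x η → T x η) {μ μ' : Distr X} :
    Lift S μ μ' → Lift T μ μ'
  | ⟨J, hJ, h1, h2⟩ => ⟨J, fun e he => h _ _ (hJ e he), h1, h2⟩

theorem lift_map {p : Distr I} {f : I → X} {η : I → Distr X}
    (h : ∀ i, p.weights i ≠ 0 → S (f i) (η i)) : Lift S (p.map f) (mix p η) := by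
  refine ⟨p.map fun i => (f i, η i), fun e he => ?_, StdSimplex.map_map _ _ _, mix_map _ _ _⟩
  obtain ⟨i, hi, rfl⟩ := map_ne_zero.1 he
  exact h i hi

theorem lift_iff_exists_fin {μ μ' : Distr X} : Lift S μ μ' ↔
    ∃ (n : ℕ) (p : Distr (Fin n)) (E : Fin n → X) (η : Fin n → Distr X),
      μ = bigOplus p (fun i => dirac (E i)) ∧ μ' = bigOplus p η ∧ ∀ i, S (E i) (η i) := by
  constructor
  · rintro ⟨J, hJ, rfl, rfl⟩
    obtain ⟨n, q, e, rfl, -, he⟩ := exists_enumeration J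
    refine ⟨n, q, fun i => (e i).1, fun i => (e i).2, ?_, ?_, fun i => hJ _ (he i)⟩
    · rw [bigOplus_eq_mix, mix_dirac_comp, StdSimplex.map_map]
    · rw [bigOplus_eq_mix, mix_map]
  · rintro ⟨n, p, E, η, rfl, rfl, h⟩
    rw [bigOplus_eq_mix, bigOplus_eq_mix, mix_dirac_comp]
    exact lift_map fun i _ => h i

theorem lift_mix {p : Distr I} {m m' : I → Distr X}
    (h : ∀ i, p.weights i ≠ 0 → Lift S (m i) (m' i)) : Lift S (mix p m) (mix p m') := by
  obtain ⟨i₀, hi₀⟩ := exists_weights_ne_zero p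
  obtain ⟨J₀, -⟩ := h i₀ hi₀
  have : Nonempty (Distr (X × Distr X)) := ⟨J₀⟩
  choose! J hJ h1 h2 using h
  refine ⟨mix p J, fun e he => ?_, ?_, ?_⟩
  · obtain ⟨i, hi, hie⟩ := mix_ne_zero.1 he
    exact hJ i hi e hie
  · rw [map_mix]; exact mix_congr h1
  · rw [mix_mix]; exact mix_congr h2

/-- Disintegrating the witness along its first marginal gives each point its own distribution over
successors. -/
theorem Lift.exists_kernel {μ μ' : Distr X} (h : Lift S μ μ') : ∃ k : X → Distr (Distr X),
    μ' = mix μ (fun x => mix (k x) id) ∧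
      ∀ x, μ.weights x ≠ 0 → ∀ η, (k x).weights η ≠ 0 → S x η := by
  obtain ⟨J, hJ, rfl, rfl⟩ := h
  obtain ⟨k, hk⟩ := exists_eq_joint J
  refine ⟨k, ?_, fun x hx η hη => hJ (x, η) ?_⟩
  · conv_lhs => rw [hk]
    rw [mix_joint]; rfl
  · rw [hk, joint_ne_zero]; exact ⟨hx, hη⟩

theorem lift_kernel {μ : Distr X} {k : X → Distr (Distr X)}
    (h : ∀ x, μ.weights x ≠ 0 → ∀ η, (k x).weights η ≠ 0 → S x η) :
    Lift S μ (mix μ (fun x => mix (k x) id)) := by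
  refine ⟨joint μ k, fun e he => ?_, map_fst_joint _ _, mix_joint _ _ _⟩
  rw [joint_ne_zero] at he
  exact h _ he.1 _ he.2

/-- The kernel depends only on the current point, so the same kernel can be run on every component
separately. -/
theorem Lift.decompose {p : Distr I} {m : I → Distr X} {μ' : Distr X}
    (h : Lift S (mix p m) μ') :
    ∃ m' : I → Distr X, μ' = mix p m' ∧ ∀ i, p.weights i ≠ 0 → Lift S (m i) (m' i) := by
  obtain ⟨k, rfl, hk⟩ := h.exists_kernel
  exact ⟨fun i => mix (m i) fun x => mix (k x) id, mix_mix _ _ _, fun i hi =>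
    lift_kernel fun x hx => hk x (mix_ne_zero.2 ⟨i, hi, hx⟩)⟩

theorem lift_dirac_mix {x : X} {d : Distr (Distr X)} (h : ∀ η, d.weights η ≠ 0 → S x η) :
    Lift S (dirac x) (mix d id) := by
  have := lift_map (p := d) (f := fun _ => x) (η := id) h
  rwa [map_const] at this

theorem lift_dirac_iff {x : X} {μ' : Distr X} : Lift S (dirac x) μ' ↔
    ∃ d : Distr (Distr X), (∀ η, d.weights η ≠ 0 → S x η) ∧ μ' = mix d id := by
  constructor
  · intro h
    obtain ⟨k, rfl, hk⟩ := h.exists_kernel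
    exact ⟨k x, hk x (dirac_ne_zero.2 rfl), mix_dirac_left _ _⟩
  · rintro ⟨d, hd, rfl⟩
    exact lift_dirac_mix hd

theorem lift_self (hS : ∀ x, S x (dirac x)) (μ : Distr X) : Lift S μ μ := by
  have := lift_map (p := μ) (f := id) (η := dirac) fun i _ => hS i
  rwa [StdSimplex.map_id, mix_dirac] at this

/-- The components may need different numbers of steps. They are moved one after another, while `hS`
lets all others idle; finiteness of the support ends the process. -/
theorem reflTransGen_lift_mix (hS : ∀ x, S x (dirac x)) {p : Distr I} {m m' : I → Distr X}
    (h : ∀ i, p.weights i ≠ 0 → Relation.ReflTransGen (Lift S) (m i) (m' i)) :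
    Relation.ReflTransGen (Lift S) (mix p m) (mix p m') := by
  classical
  have key : ∀ s : Finset I, s ⊆ p.weights.support →
      Relation.ReflTransGen (Lift S) (mix p m) (mix p fun i => if i ∈ s then m' i else m i) := by
    intro s
    induction s using Finset.induction_on with
    | empty => intro _; simpa using Relation.ReflTransGen.refl
    | insert j s hj ih =>
      intro hs
      refine (ih fun i hi => hs (by simp [hi])).trans ?_
      have hjp : p.weights j ≠ 0 := by simpa using hs (Finset.mem_insert_self j s)
      have := Relation.ReflTransGen.lift (p := Lift S)
        (fun a => mix p (Function.update (fun i => if i ∈ s then m' i else m i) j a))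
        (fun a b hab => lift_mix fun i _ => by
          by_cases hij : i = j
          · subst hij; simpa using hab
          · simpa [hij] using lift_self hS _) _ _ (h j hjp)
      simp only [Function.onFun] at this
      convert! this using 2
      · funext i
        by_cases hij : i = j
        · subst hij; simp [hj]
        · simp [hij]
      · funext i
        by_cases hij : i = j
        · subst hij; simp
        · simp [hij]
  have h1 := key _ subset_rfl
  rwa [mix_congr (g := m') fun i hi => if_pos (Finsupp.mem_support_iff.2 hi)] at h1

theorem reflTransGen_lift_decompose {p : Distr I} {m : I → Distr X} {ζ : Distr X}
    (h : Relation.ReflTransGen (Lift S) (mix p m) ζ) :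
    ∃ m' : I → Distr X, ζ = mix p m' ∧
      ∀ i, p.weights i ≠ 0 → Relation.ReflTransGen (Lift S) (m i) (m' i) := by
  induction h with
  | refl => exact ⟨m, rfl, fun _ _ => .refl⟩
  | tail _ hbc ih =>
    obtain ⟨m', rfl, hm'⟩ := ih
    obtain ⟨m'', rfl, hm''⟩ := hbc.decompose
    exact ⟨m'', rfl, fun i hi => (hm' i hi).tail (hm'' i hi)⟩

/-- A mixture of a set of paths from a point splits according to the first proper step. -/
theorem reflTransGen_lift_dirac {x : X} {ζ : Distr X}
    (h : Relation.ReflTransGen (Lift fun y η => S y η ∨ η = dirac y) (dirac x) ζ) :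
    ∃ d : Distr (Option (Distr X) × Distr X), ζ = mix d Prod.snd ∧
      ∀ e, d.weights e ≠ 0 → (∀ ξ, e = (none, ξ) → ξ = dirac x) ∧
        ∀ η ξ, e = (some η, ξ) → S x η ∧
          Relation.ReflTransGen (Lift fun y η => S y η ∨ η = dirac y) η ξ := by
  induction h with
  | refl =>
    refine ⟨dirac (none, dirac x), by rw [mix_dirac_left], fun e he => ?_⟩
    rw [dirac_ne_zero] at he
    subst he
    simp
  | tail _ hbc ih =>
    obtain ⟨d, rfl, hd⟩ := ih
    obtain ⟨m', rfl, hm'⟩ := hbc.decompose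
    have : ∀ e, d.weights e ≠ 0 → ∃ d' : Distr (Option (Distr X) × Distr X),
        m' e = mix d' Prod.snd ∧ ∀ e, d'.weights e ≠ 0 → (∀ ξ, e = (none, ξ) → ξ = dirac x) ∧
        ∀ η ξ, e = (some η, ξ) → S x η ∧
          Relation.ReflTransGen (Lift fun y η => S y η ∨ η = dirac y) η ξ := by
      -- The tag `none` marks mass still resting at `x`, the tag `some η` mass whose first proper
      -- step led to `η`. Resting mass may acquire a tag in the new step; tagged mass only prolongs
      -- its path.
      rintro ⟨_ | η, ξ⟩ he
      · have h1 := hm' _ he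
        obtain rfl := (hd _ he).1 ξ rfl
        obtain ⟨d₂, hd₂, h2⟩ := lift_dirac_iff.1 h1
        classical
        refine ⟨d₂.map fun η => (if η = dirac x then none else some η, η), ?_, fun e he' => ?_⟩
        · rw [h2, mix_map]; rfl
        · obtain ⟨η, hη, rfl⟩ := map_ne_zero.1 he'
          by_cases hx : η = dirac x
          · simp [hx]
          · simp only [if_neg hx, Prod.mk.injEq, reduceCtorEq, false_and, false_imp_iff,
              implies_true, true_and, Option.some.injEq]
            rintro _ _ ⟨rfl, rfl⟩
            exact ⟨(hd₂ η hη).resolve_right hx, .refl⟩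
      · have h1 := hm' _ he
        obtain ⟨h2, h3⟩ := (hd _ he).2 η ξ rfl
        refine ⟨dirac (some η, m' (some η, ξ)), by rw [mix_dirac_left], fun e he' => ?_⟩
        rw [dirac_ne_zero] at he'
        subst he'
        simp only [Prod.mk.injEq, reduceCtorEq, false_and, false_imp_iff, implies_true,
          Option.some.injEq, true_and]
        rintro _ _ ⟨rfl, rfl⟩
        exact ⟨h2, h3.tail h1⟩
    have hne : Nonempty (Distr (Option (Distr X) × Distr X)) := ⟨d⟩
    choose! d' h1 h2 using this
    refine ⟨mix d d', by rw [mix_mix]; exact mix_congr h1, fun e he => ?_⟩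
    obtain ⟨i, hi, hie⟩ := mix_ne_zero.1 he
    exact h2 i hi e hie

end Lifting

-- Transitions as liftings

section Steps

variable {A : Type u} {τ a : A} {μ μ' ν : Distr (NProc A)}

/-- The transitions of a process, where for `α = τ` staying put is also allowed. -/
def OptStep (τ a : A) (x : NProc A) (η : Distr (NProc A)) : Prop :=
  NStep x a η ∨ (a = τ ∧ η = dirac x)

theorem dStep_iff_lift : DStep μ a μ' ↔ Lift (fun x η => NStep x a η) μ μ' :=
  (lift_iff_exists_fin (S := fun x η => NStep x a η)).symm

/-- The three clauses of `PartialStep` say that all, none or a proper fraction of the mass moves,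
which is a free choice between moving and idling at every point. -/
theorem partialStep_iff_lift : PartialStep τ μ a μ' ↔ Lift (OptStep τ a) μ μ' := by
  classical
  constructor
  · rintro (h | ⟨rfl, rfl⟩ | ⟨rfl, r, μ₁, μ₂, μ₁', μ₂', -, -, rfl, rfl, h, rfl⟩)
    · exact (dStep_iff_lift.1 h).mono fun _ _ h => .inl h
    · exact lift_self (fun x => .inr ⟨rfl, rfl⟩) _
    · obtain ⟨p, -, -, hp⟩ := oplus_eq_mix r
      have e1 := hp _ ![μ₁, μ₂]
      have e2 := hp _ ![μ₁', μ₂]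
      simp only [Matrix.cons_val_zero, Matrix.cons_val_one] at e1 e2
      rw [e1, e2]
      refine lift_mix fun i _ => ?_
      fin_cases i
      · exact (dStep_iff_lift.1 h).mono fun _ _ h => .inl h
      · exact lift_self (fun x => .inr ⟨rfl, rfl⟩) _
  · rintro ⟨J, hJ, rfl, rfl⟩
    by_cases h1 : ∀ e, J.weights e ≠ 0 → NStep e.1 a e.2
    · exact .inl (dStep_iff_lift.2 ⟨J, h1, rfl, rfl⟩)
    push Not at h1
    obtain ⟨e₁, he₁, hn₁⟩ := h1
    obtain ⟨rfl, -⟩ := (hJ e₁ he₁).resolve_left hn₁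
    have hstay : ∀ ρ : Distr (NProc A × Distr (NProc A)),
        (∀ e, ρ.weights e ≠ 0 → e.2 = dirac e.1) → mix ρ Prod.snd = ρ.map Prod.fst := by
      intro ρ hρ
      rw [mix_congr hρ, mix_dirac_comp]
    by_cases h2 : ∀ e, J.weights e ≠ 0 → ¬ NStep e.1 a e.2
    · exact .inr (.inl ⟨rfl, hstay J fun e he => ((hJ e he).resolve_left (h2 e he)).2⟩)
    push Not at h2
    obtain ⟨e₂, he₂, hn₂⟩ := h2
    -- Conditioning `J` on the moving pairs and on the idling ones yields the two components; both
    -- have positive mass, so `r` lies strictly between 0 and 1.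
    let s : Set (NProc A × Distr (NProc A)) := {e | NStep e.1 a e.2}
    have hs : ∃ e ∈ s, J.weights e ≠ 0 := ⟨e₂, hn₂, he₂⟩
    have hs' : ∃ e ∈ sᶜ, J.weights e ≠ 0 := ⟨e₁, hn₁, he₁⟩
    have hsplit := StdSimplex.convexCombPair_restrict_restrict_compl J s hs hs'
    set r : ℝ := (J.weights.filter (· ∈ s)).sum fun _ k => k with hr
    set t : ℝ := (J.weights.filter (· ∉ s)).sum fun _ k => k with ht
    have hpos : ∀ (q : NProc A × Distr (NProc A) → Prop) [DecidablePred q], (∃ e, q e ∧ J.weights e ≠ 0) →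
        0 < (J.weights.filter q).sum fun _ k => k := by
      rintro q _ ⟨e, hq, he⟩
      have hnn : ∀ e, 0 ≤ J.weights.filter q e := fun e => by
        rw [Finsupp.filter_apply]; split_ifs <;> simp
      refine Finset.sum_pos' (fun e _ => hnn e) ⟨e, by simp [hq, he], ?_⟩
      rw [Finsupp.filter_apply_pos _ _ hq]; exact weights_pos he
    have hr0 : 0 < r := hpos (· ∈ s) hs
    have ht0 : 0 < t := hpos (· ∉ s) hs'
    have hrt : r + t = 1 := by
      rw [hr, ht, ← J.total]
      have h3 := Finsupp.filter_add_filter_not J.weights (· ∈ s)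
      conv_rhs => rw [← h3]
      rw [Finsupp.sum_add_index' (by simp) (by simp)]
    let R : unitInterval := ⟨r, hr0.le, by linarith⟩
    have hJ' : J = oplus R (J.restrict s hs) (J.restrict sᶜ hs') := by
      apply distr_ext
      intro e
      rw [oplus_apply]
      conv_lhs => rw [← hsplit]
      simp only [StdSimplex.weights_convexCombPair, Finsupp.add_apply, Finsupp.smul_apply,
        smul_eq_mul]
      rw [← hr, ← ht, show t = 1 - r by linarith]
    have hsupp : ∀ e, (J.restrict s hs).weights e ≠ 0 → e ∈ s := fun e he => by
      have : e ∈ (J.restrict s hs).weights.support := Finsupp.mem_support_iff.2 he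
      rw [StdSimplex.support_weights_restrict] at this
      exact (Finset.mem_filter.1 this).2
    have hsupp' : ∀ e, (J.restrict sᶜ hs').weights e ≠ 0 → J.weights e ≠ 0 ∧ e ∉ s :=
      fun e he => by
        have : e ∈ (J.restrict sᶜ hs').weights.support := Finsupp.mem_support_iff.2 he
        rw [StdSimplex.support_weights_restrict] at this
        simpa using Finset.mem_filter.1 this
    generalize J.restrict s hs = J₁ at *
    generalize J.restrict sᶜ hs' = J₂ at *
    refine .inr (.inr ⟨rfl, R, J₁.map Prod.fst, J₂.map Prod.fst, mix J₁ Prod.snd, mix J₂ Prod.snd,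
      hr0, ?_, ?_, ?_, dStep_iff_lift.2 ⟨J₁, fun e he => hsupp e he, rfl, rfl⟩, ?_⟩)
    · exact Subtype.mk_lt_mk.2 (by linarith)
    · obtain ⟨p, -, -, hp⟩ := oplus_eq_mix R
      have e1 := hp _ ![J₁, J₂]
      have e2 := hp _ ![J₁.map Prod.fst, J₂.map Prod.fst]
      simp only [Matrix.cons_val_zero, Matrix.cons_val_one] at e1 e2
      rw [hJ', e1, e2, map_mix]
      refine mix_congr fun i _ => ?_
      fin_cases i <;> rfl
    · obtain ⟨p, -, -, hp⟩ := oplus_eq_mix R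
      have e1 := hp _ ![J₁, J₂]
      have e2 := hp _ ![mix J₁ Prod.snd, mix J₂ Prod.snd]
      simp only [Matrix.cons_val_zero, Matrix.cons_val_one] at e1 e2
      rw [hJ', e1, e2, mix_mix]
      refine mix_congr fun i _ => ?_
      fin_cases i <;> rfl
    · exact (hstay J₂ fun e he => ((hJ e (hsupp' e he).1).resolve_left (hsupp' e he).2).2).symm

theorem weakStep_eq : WeakStep τ = Relation.ReflTransGen (Lift (OptStep τ τ)) := by
  unfold WeakStep
  congr 1
  ext μ μ'
  exact partialStep_iff_lift

variable {I : Type*}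

theorem optStep_tau_self (x : NProc A) : OptStep τ τ x (dirac x) := .inr ⟨rfl, rfl⟩

theorem partialStep_tau_self : PartialStep τ μ τ μ := .inr (.inl ⟨rfl, rfl⟩)

theorem partialStep_mix {p : Distr I} {m m' : I → Distr (NProc A)}
    (h : ∀ i, p.weights i ≠ 0 → PartialStep τ (m i) a (m' i)) :
    PartialStep τ (mix p m) a (mix p m') :=
  partialStep_iff_lift.2 (lift_mix fun i hi => partialStep_iff_lift.1 (h i hi))

theorem weakStep_refl : WeakStep τ μ μ := .refl

theorem weakStep_mix {p : Distr I} {m m' : I → Distr (NProc A)}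
    (h : ∀ i, p.weights i ≠ 0 → WeakStep τ (m i) (m' i)) :
    WeakStep τ (mix p m) (mix p m') := by
  rw [weakStep_eq] at h ⊢
  exact reflTransGen_lift_mix optStep_tau_self h

theorem weakStep_decompose {p : Distr I} {m : I → Distr (NProc A)}
    (h : WeakStep τ (mix p m) ν) : ∃ m' : I → Distr (NProc A), ν = mix p m' ∧
      ∀ i, p.weights i ≠ 0 → WeakStep τ (m i) (m' i) := by
  rw [weakStep_eq] at h ⊢
  exact reflTransGen_lift_decompose h

end Steps

-- Bisimilarity is a congruence for mixtures and an equivalence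

section Bisimilarity

variable {A : Type u} {τ a : A} {μ μ' ν ν' ρ : Distr (NProc A)} {I : Type*}

instance : Nonempty (Distr (NProc A)) := ⟨dirac NProc.nil⟩

theorem bisimilar_refl (μ : Distr (NProc A)) : Bisimilar τ μ μ := by
  refine ⟨Eq, ⟨⟨fun _ _ h => h.symm, ?_⟩, ?_⟩, rfl⟩
  · rintro μ _ rfl n p μs rfl
    exact ⟨_, μs, .refl, rfl, rfl, fun _ => rfl⟩
  · rintro μ _ rfl a μ' h
    exact ⟨μ, μ', .refl, .inl h, rfl, rfl⟩

theorem Bisimilar.symm (h : Bisimilar τ μ ν) : Bisimilar τ ν μ :=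
  (bisimilar_isBranchingBisimulation τ).1.1 _ _ h

theorem Bisimilar.dStep (h : Bisimilar τ μ ν) (hs : DStep μ a μ') :
    ∃ ν₁ ν', WeakStep τ ν ν₁ ∧ PartialStep τ ν₁ a ν' ∧ Bisimilar τ μ ν₁ ∧ Bisimilar τ μ' ν' :=
  (bisimilar_isBranchingBisimulation τ).2 _ _ h a _ hs

theorem Bisimilar.decompose {p : Distr I} {m : I → Distr (NProc A)}
    (h : Bisimilar τ (mix p m) ν) : ∃ n : I → Distr (NProc A), WeakStep τ ν (mix p n) ∧
      Bisimilar τ (mix p m) (mix p n) ∧ ∀ i, p.weights i ≠ 0 → Bisimilar τ (m i) (n i) := by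
  obtain ⟨N, q, e, rfl, he, -⟩ := exists_enumeration p
  rw [mix_map] at h
  obtain ⟨ν', νs, h1, h2, rfl, h4⟩ := (bisimilar_isBranchingBisimulation τ).1.2 _ _ h N q _
    (bigOplus_eq_mix _ _).symm
  have hinv : ∀ j, Function.extend e νs (fun _ => ν) (e j) = νs j := he.extend_apply _ _
  refine ⟨Function.extend e νs fun _ => ν, ?_, ?_, fun i hi => ?_⟩
  · simpa only [mix_map, hinv, bigOplus_eq_mix] using h1
  · simpa only [mix_map, hinv, bigOplus_eq_mix] using h2
  · obtain ⟨j, -, rfl⟩ := map_ne_zero.1 hi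
    simpa only [hinv] using h4 j

/-- The closure of bisimilarity under convex combinations. -/
def MixBisimilar (τ : A) (μ ν : Distr (NProc A)) : Prop :=
  ∃ J : Distr (Distr (NProc A) × Distr (NProc A)),
    (∀ e, J.weights e ≠ 0 → Bisimilar τ e.1 e.2) ∧ μ = mix J Prod.fst ∧ ν = mix J Prod.snd

theorem mixBisimilar_mix {p : Distr I} {m n : I → Distr (NProc A)}
    (h : ∀ i, p.weights i ≠ 0 → Bisimilar τ (m i) (n i)) :
    MixBisimilar τ (mix p m) (mix p n) := by
  refine ⟨p.map fun i => (m i, n i), fun e he => ?_, by rw [mix_map], by rw [mix_map]⟩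
  obtain ⟨i, hi, rfl⟩ := map_ne_zero.1 he
  exact h i hi

theorem Bisimilar.mixBisimilar (h : Bisimilar τ μ ν) : MixBisimilar τ μ ν := by
  have := mixBisimilar_mix (p := dirac ()) (m := fun _ => μ) (n := fun _ => ν) fun _ _ => h
  simpa only [mix_const] using this

/-- The left distribution is decomposed twice: by `J` into bisimilar pairs and by `q` into the `m
l`. Bayesian conditioning yields a common refinement `me e l`: `post` is the law of the label given
the outcome, and `t' l` the law of the pair given the label. Each second component `e.2` then
matches the refinement of `e.1`, and the matches are regrouped by label. -/
theorem MixBisimilar.decompose {L : Type*} {q : Distr L} {m : L → Distr (NProc A)}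
    (h : MixBisimilar τ (mix q m) ν) : ∃ n : L → Distr (NProc A), WeakStep τ ν (mix q n) ∧
      MixBisimilar τ (mix q m) (mix q n) ∧
      ∀ l, q.weights l ≠ 0 → MixBisimilar τ (m l) (n l) := by
  obtain ⟨J, hJ, hμ, rfl⟩ := h
  -- the posterior distribution of the component, given a point of the support
  obtain ⟨post, hpost⟩ := exists_eq_joint_swap (joint q m)
  rw [map_snd_joint] at hpost
  have hsplit : ∀ e : Distr (NProc A) × Distr (NProc A), ∃ me : L → Distr (NProc A),
      joint e.1 post = (joint (mix e.1 post) me).map Prod.swap := by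
    intro e
    obtain ⟨k, hk⟩ := exists_eq_joint_swap (joint e.1 post)
    rw [map_snd_joint] at hk
    exact ⟨k, hk⟩
  choose me hme using hsplit
  have hfst : ∀ e : Distr (NProc A) × Distr (NProc A), e.1 = mix (mix e.1 post) (me e) := by
    intro e
    have := congrArg (fun W => W.map Prod.fst) (hme e)
    simp only [map_fst_joint, StdSimplex.map_map, Prod.fst_swap] at this
    exact this.trans (map_snd_joint _ _)
  obtain ⟨t', ht'⟩ := exists_eq_joint_swap (joint J fun e => mix e.1 post)
  have hW : (joint J fun e => mix e.1 post).map Prod.snd = q := by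
    rw [map_snd_joint, ← mix_mix, ← hμ, ← map_snd_joint (mix q m) post]
    have := congrArg (fun W => W.map Prod.fst) hpost
    simp only [map_fst_joint, StdSimplex.map_map, Prod.fst_swap] at this
    exact this.symm
  rw [hW] at ht'
  -- The refined pieces, regrouped by label, give back the `m l`: both kernels have the same joint
  -- law with `q`, and `joint_inj` cancels the nonzero weights.
  have hcomp : joint q m = joint q fun l => mix (t' l) fun e => me e l := by
    rw [hpost, hμ]
    have h1 : joint (mix J Prod.fst) post = mix J fun e => joint e.1 post := mix_mix _ _ _
    rw [h1, map_mix]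
    have h2 : (mix J fun e => (joint e.1 post).map Prod.swap) =
        mix (joint J fun e => mix e.1 post) fun x => (me x.1 x.2).map (Prod.mk x.2) := by
      rw [mix_joint]
      refine mix_congr fun e _ => ?_
      rw [hme e, StdSimplex.map_map]
      exact StdSimplex.map_id _
    rw [h2, ht', mix_map, mix_joint]
    refine mix_congr fun l _ => ?_
    rw [map_mix]; rfl
  have hsupp : ∀ l e, q.weights l ≠ 0 → (t' l).weights e ≠ 0 →
      J.weights e ≠ 0 ∧ (mix e.1 post).weights l ≠ 0 := by
    intro l e hl he
    have : (joint J fun e => mix e.1 post).weights (e, l) ≠ 0 := by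
      rw [ht', map_ne_zero]
      exact ⟨(l, e), joint_ne_zero.2 ⟨hl, he⟩, rfl⟩
    exact joint_ne_zero.1 this
  have hmatch : ∀ e, J.weights e ≠ 0 → ∃ n : L → Distr (NProc A),
      WeakStep τ e.2 (mix (mix e.1 post) n) ∧ Bisimilar τ e.1 (mix (mix e.1 post) n) ∧
      ∀ l, (mix e.1 post).weights l ≠ 0 → Bisimilar τ (me e l) (n l) := by
    intro e he
    have h1 := hJ e he
    rw [hfst e] at h1
    have := h1.decompose
    rwa [← hfst e] at this
  choose! n hn1 hn2 hn3 using hmatch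
  have hmix : (mix q fun l => mix (t' l) fun e => n e l) =
      mix J fun e => mix (mix e.1 post) (n e) := by
    rw [← mix_joint J (fun e => mix e.1 post) (fun x => n x.1 x.2), ht', mix_map, mix_joint]
    rfl
  refine ⟨fun l => mix (t' l) fun e => n e l, ?_, ?_, fun l hl => ?_⟩
  · rw [hmix]; exact weakStep_mix hn1
  · rw [hmix, hμ]; exact mixBisimilar_mix hn2
  · rw [joint_inj hcomp hl]
    exact mixBisimilar_mix fun e he =>
      hn3 e (hsupp l e hl he).1 l (hsupp l e hl he).2

theorem mixBisimilar_isBranchingBisimulation (τ : A) :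
    IsBranchingBisimulation τ (MixBisimilar τ) := by
  classical
  refine ⟨⟨?_, ?_⟩, ?_⟩
  · rintro _ _ ⟨J, hJ, rfl, rfl⟩
    exact mixBisimilar_mix fun e he => (hJ e he).symm
  · rintro μ ν h N q m rfl
    rw [bigOplus_eq_mix] at h ⊢
    obtain ⟨n, h1, h2, h3⟩ := h.decompose
    -- Weak decomposability also asks for related partners at weight zero; there `m l` is its own
    -- partner.
    have hn : (mix q fun l => if q.weights l ≠ 0 then n l else m l) = mix q n :=
      mix_congr fun l hl => if_pos hl
    refine ⟨_, fun l => if q.weights l ≠ 0 then n l else m l, h1, h2,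
      hn.symm.trans (bigOplus_eq_mix _ _).symm, fun l => ?_⟩
    by_cases hl : q.weights l ≠ 0
    · simpa only [if_pos hl] using h3 l hl
    · simpa only [if_neg hl] using (bisimilar_refl (m l)).mixBisimilar
  · rintro _ _ ⟨J, hJ, rfl, rfl⟩ a μ' hs
    rw [dStep_iff_lift] at hs
    obtain ⟨m', rfl, hm'⟩ := hs.decompose
    have : ∀ e, J.weights e ≠ 0 → ∃ ν₁ ν', WeakStep τ e.2 ν₁ ∧ PartialStep τ ν₁ a ν' ∧
        Bisimilar τ e.1 ν₁ ∧ Bisimilar τ (m' e) ν' := fun e he =>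
      (hJ e he).dStep (dStep_iff_lift.2 (hm' e he))
    choose! ν₁ ν' h1 h2 h3 h4 using this
    exact ⟨mix J ν₁, mix J ν', weakStep_mix h1, partialStep_mix h2, mixBisimilar_mix h3,
      mixBisimilar_mix h4⟩

/-- Bisimilarity is a congruence for convex combinations. -/
theorem bisimilar_mix {p : Distr I} {m n : I → Distr (NProc A)}
    (h : ∀ i, p.weights i ≠ 0 → Bisimilar τ (m i) (n i)) :
    Bisimilar τ (mix p m) (mix p n) :=
  ⟨_, mixBisimilar_isBranchingBisimulation τ, mixBisimilar_mix h⟩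

/-- The definition only answers steps in which all mass moves. Decomposing the source along the
pairs of `J` isolates the moving pieces, which are answered by definition, from the idle ones, which
are answered by idling. -/
theorem Bisimilar.partialStep (h : Bisimilar τ μ ν) (hs : PartialStep τ μ a μ') :
    ∃ ν₁ ν', WeakStep τ ν ν₁ ∧ PartialStep τ ν₁ a ν' ∧ Bisimilar τ μ ν₁ ∧ Bisimilar τ μ' ν' := by
  rw [partialStep_iff_lift] at hs
  obtain ⟨J, hJ, rfl, rfl⟩ := hs
  have hfst : J.map Prod.fst = mix J fun e => dirac e.1 := (mix_dirac_comp _ _).symm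
  rw [hfst] at h ⊢
  obtain ⟨n, h1, h2, h3⟩ := h.decompose
  have : ∀ e, J.weights e ≠ 0 → ∃ ν₁ ν', WeakStep τ (n e) ν₁ ∧ PartialStep τ ν₁ a ν' ∧
      Bisimilar τ (dirac e.1) ν₁ ∧ Bisimilar τ e.2 ν' := by
    rintro ⟨x, η⟩ he
    rcases hJ _ he with hs | ⟨rfl, hs⟩
    · refine (h3 _ he).dStep (dStep_iff_lift.2 ?_)
      have := lift_map (p := dirac ()) (S := fun x η => NStep x a η) (f := fun _ => x)
        (η := fun _ => η) fun _ _ => hs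
      simpa only [mix_const, map_const] using this
    · refine ⟨n (x, η), n (x, η), .refl, partialStep_tau_self, h3 _ he, ?_⟩
      simp only at hs
      subst hs
      exact h3 _ he
  choose! ν₁ ν' g1 g2 g3 g4 using this
  exact ⟨mix J ν₁, mix J ν', h1.trans (weakStep_mix g1), partialStep_mix g2, bisimilar_mix g3,
    bisimilar_mix g4⟩

theorem Bisimilar.weakStep (h : Bisimilar τ μ ν) (hs : WeakStep τ μ μ') :
    ∃ ν', WeakStep τ ν ν' ∧ Bisimilar τ μ' ν' := by
  induction hs with
  | refl => exact ⟨ν, .refl, h⟩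
  | tail _ hbc ih =>
    obtain ⟨ν', h1, h2⟩ := ih
    obtain ⟨ν₁, ν₂, h3, h4, -, h5⟩ := h2.partialStep hbc
    exact ⟨ν₂, (h1.trans h3).tail h4, h5⟩

/-- The composite relation is a bisimulation: the weak moves by which the middle distribution
answers are transferred to the right by `Bisimilar.weakStep`. -/
theorem Bisimilar.trans (h : Bisimilar τ μ ν) (h' : Bisimilar τ ν ρ) : Bisimilar τ μ ρ := by
  refine ⟨fun μ ρ => ∃ ν, Bisimilar τ μ ν ∧ Bisimilar τ ν ρ, ⟨⟨?_, ?_⟩, ?_⟩, ν, h, h'⟩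
  · rintro μ ρ ⟨ν, h, h'⟩
    exact ⟨ν, h'.symm, h.symm⟩
  · rintro μ ρ ⟨ν, h, h'⟩ N p m rfl
    obtain ⟨ν', n, h1, h2, rfl, h3⟩ := (bisimilar_isBranchingBisimulation τ).1.2 _ _ h N p m rfl
    obtain ⟨ρ', h4, h5⟩ := h'.weakStep h1
    obtain ⟨ρ'', s, h6, h7, rfl, h8⟩ := (bisimilar_isBranchingBisimulation τ).1.2 _ _ h5 N p n rfl
    exact ⟨_, s, h4.trans h6, ⟨_, h2, h7⟩, rfl, fun i => ⟨_, h3 i, h8 i⟩⟩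
  · rintro μ ρ ⟨ν, h, h'⟩ a μ' hs
    obtain ⟨ν₁, ν', h1, h2, h3, h4⟩ := h.dStep hs
    obtain ⟨ρ₁, h5, h6⟩ := h'.weakStep h1
    obtain ⟨ρ₂, ρ', h7, h8, h9, h10⟩ := h6.partialStep h2
    exact ⟨ρ₂, ρ', h5.trans h7, h8, ⟨ν₁, h3, h9⟩, ⟨ν', h4, h10⟩⟩

end Bisimilarity

-- Ultrafilter limits of distributions

section Limits

variable {I J X : Type*}

/-- Pointwise convergence of a sequence of distributions along a fixed ultrafilter. -/
def ULim (m : ℕ → Distr X) (μ : Distr X) : Prop :=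
  ∀ x, Tendsto (fun k => (m k).weights x) (hyperfilter ℕ : Filter ℕ) (𝓝 (μ.weights x))

theorem ULim.congr {m n : ℕ → Distr X} {μ : Distr X} (h : ULim m μ)
    (hmn : ∀ᶠ k in (hyperfilter ℕ : Filter ℕ), m k = n k) : ULim n μ := fun x =>
  (h x).congr' (hmn.mono fun k hk => by rw [hk])

theorem ULim.unique {m : ℕ → Distr X} {μ ν : Distr X} (h : ULim m μ) (h' : ULim m ν) : μ = ν :=
  distr_ext fun x => tendsto_nhds_unique (h x) (h' x)

theorem uLim_const (μ : Distr X) : ULim (fun _ => μ) μ := fun _ => tendsto_const_nhds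

theorem ULim.eventually_ne_zero {m : ℕ → Distr X} {μ : Distr X} (h : ULim m μ) {x : X}
    (hx : μ.weights x ≠ 0) : ∀ᶠ k in (hyperfilter ℕ : Filter ℕ), (m k).weights x ≠ 0 :=
  (h x).eventually_ne hx

theorem ULim.support_subset {m : ℕ → Distr X} {μ : Distr X} (h : ULim m μ) {s : Finset X}
    (hs : ∀ᶠ k in (hyperfilter ℕ : Filter ℕ), ∀ x, (m k).weights x ≠ 0 → x ∈ s) :
    ∀ x, μ.weights x ≠ 0 → x ∈ s := fun x hx => by
  obtain ⟨k, h1, h2⟩ := (hs.and (h.eventually_ne_zero hx)).exists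
  exact h1 x h2

/-- Each coordinate stays in the compact interval [0, 1], so it converges along the ultrafilter
without passing to a subsequence; the fixed finite set `s` prevents loss of mass. -/
theorem exists_uLim {m : ℕ → Distr X} {s : Finset X}
    (hs : ∀ᶠ k in (hyperfilter ℕ : Filter ℕ), ∀ x, (m k).weights x ≠ 0 → x ∈ s) :
    ∃ μ, ULim m μ := by
  classical
  have hlim : ∀ x, ∃ r : ℝ,
      Tendsto (fun k => (m k).weights x) (hyperfilter ℕ : Filter ℕ) (𝓝 r) := by
    intro x
    have hc : IsCompact (Set.Icc (0 : ℝ) 1) := isCompact_Icc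
    obtain ⟨r, -, hr⟩ := hc.ultrafilter_le_nhds
      ((hyperfilter ℕ).map fun k => (m k).weights x) (by
        rw [le_principal_iff]
        exact Filter.mem_map.2 <| Filter.univ_mem' fun k => ⟨(m k).nonneg x, weights_le_one _ _⟩)
    exact ⟨r, hr⟩
  choose f hf using hlim
  have hzero : ∀ x, f x ≠ 0 → x ∈ s := fun x hx => by
    obtain ⟨k, h1, h2⟩ := (hs.and ((hf x).eventually_ne hx)).exists
    exact h1 x h2
  let w : X →₀ ℝ := Finsupp.onFinset s f hzero
  have hsum : ∑ x ∈ s, f x = 1 := by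
    refine tendsto_nhds_unique (tendsto_finsetSum s fun x _ => hf x) ?_
    exact tendsto_const_nhds.congr' (hs.mono fun k hk => (sum_weights_of_subset (m k) hk).symm)
  refine ⟨⟨w, fun x => ge_of_tendsto' (hf x) fun k => (m k).nonneg x, ?_⟩, fun x => hf x⟩
  rw [Finsupp.onFinset_sum _ (by simp), hsum]

/-- Components of vanishing limit weight need not converge: their contribution is bounded by the
weight itself. -/
theorem uLim_mix {p : ℕ → Distr I} {f : ℕ → I → Distr X} {q : Distr I} {g : I → Distr X}
    {s : Finset I} (hs : ∀ᶠ k in (hyperfilter ℕ : Filter ℕ), ∀ i, (p k).weights i ≠ 0 → i ∈ s)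
    (hp : ULim p q) (hf : ∀ i, q.weights i ≠ 0 → ULim (fun k => f k i) (g i)) :
    ULim (fun k => mix (p k) (f k)) (mix q g) := by
  intro x
  rw [mix_apply_of_subset q g x (hp.support_subset hs)]
  have : Tendsto (fun k => ∑ i ∈ s, (p k).weights i * (f k i).weights x)
      (hyperfilter ℕ : Filter ℕ) (𝓝 (∑ i ∈ s, q.weights i * (g i).weights x)) := by
    refine tendsto_finsetSum s fun i _ => ?_
    by_cases hi : q.weights i = 0
    · rw [hi, zero_mul]
      have h0 := hp i
      rw [hi] at h0
      exact squeeze_zero (fun k => mul_nonneg ((p k).nonneg i) ((f k i).nonneg x))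
        (fun k => mul_le_of_le_one_right ((p k).nonneg i) (weights_le_one _ _)) h0
    · exact (hp i).mul (hf i hi x)
  exact this.congr' (hs.mono fun k hk => (mix_apply_of_subset (p k) (f k) x hk).symm)

theorem uLim_map {p : ℕ → Distr I} {q : Distr I} (f : I → X) {s : Finset I}
    (hs : ∀ᶠ k in (hyperfilter ℕ : Filter ℕ), ∀ i, (p k).weights i ≠ 0 → i ∈ s)
    (hp : ULim p q) : ULim (fun k => (p k).map f) (q.map f) := by
  simp only [← mix_dirac_comp]
  exact uLim_mix hs hp fun i _ => uLim_const _

/-- A property of distributions that is preserved by limits along the fixed ultrafilter. -/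
def UClosed (C : Distr X → Prop) : Prop :=
  ∀ (m : ℕ → Distr X) (μ : Distr X), (∀ᶠ k in (hyperfilter ℕ : Filter ℕ), C (m k)) →
    ULim m μ → C μ

theorem exists_uLim_kernel {p : ℕ → Distr I} {q : Distr I} {κ : ℕ → I → Distr X}
    {C : I → Distr X → Prop} {s : Finset I} {t : I → Finset X}
    (hs : ∀ᶠ k in (hyperfilter ℕ : Filter ℕ), ∀ i, (p k).weights i ≠ 0 → i ∈ s)
    (hp : ULim p q)
    (hC : ∀ᶠ k in (hyperfilter ℕ : Filter ℕ), ∀ i, (p k).weights i ≠ 0 → C i (κ k i))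
    (ht : ∀ i η, C i η → ∀ x, η.weights x ≠ 0 → x ∈ t i)
    (hcl : ∀ i ∈ s, UClosed (C i)) :
    ∃ g : I → Distr X, (∀ i, q.weights i ≠ 0 → C i (g i)) ∧
      ULim (fun k => mix (p k) (κ k)) (mix q g) := by
  have : ∀ i, q.weights i ≠ 0 → ∃ η, C i η ∧ ULim (fun k => κ k i) η := by
    intro i hi
    have hev : ∀ᶠ k in (hyperfilter ℕ : Filter ℕ), C i (κ k i) :=
      (hC.and (hp.eventually_ne_zero hi)).mono fun k hk => hk.1 i hk.2
    obtain ⟨η, hη⟩ := exists_uLim (m := fun k => κ k i) (s := t i)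
      (hev.mono fun k hk => ht i _ hk)
    exact ⟨η, hcl i (hp.support_subset hs i hi) _ _ hev hη, hη⟩
  obtain ⟨i₀, hi₀⟩ := exists_weights_ne_zero q
  have hne : Nonempty (Distr X) := ⟨κ 0 i₀⟩
  choose! g hg1 hg2 using this
  exact ⟨g, hg1, uLim_mix hs hp hg2⟩

theorem lift_uLim {S : X → Distr X → Prop} (hfin : ∀ x, {η | S x η}.Finite)
    {m m' : ℕ → Distr X} {μ μ' : Distr X} {s : Finset X}
    (hs : ∀ᶠ k in (hyperfilter ℕ : Filter ℕ), ∀ x, (m k).weights x ≠ 0 → x ∈ s)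
    (h : ∀ᶠ k in (hyperfilter ℕ : Filter ℕ), Lift S (m k) (m' k))
    (hm : ULim m μ) (hm' : ULim m' μ') : Lift S μ μ' := by
  classical
  have : ∀ k, ∃ J : Distr (X × Distr X), Lift S (m k) (m' k) → (∀ e, J.weights e ≠ 0 →
      S e.1 e.2) ∧ J.map Prod.fst = m k ∧ mix J Prod.snd = m' k := by
    intro k
    by_cases hk : Lift S (m k) (m' k)
    · obtain ⟨J, hJ⟩ := hk
      exact ⟨J, fun _ => hJ⟩
    · obtain ⟨x, -⟩ := exists_weights_ne_zero (m k)
      exact ⟨dirac (x, m k), fun h => (hk h).elim⟩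
  choose J hJ using this
  -- Finite branching confines all witnesses to one finite set of pairs, so they have a limit.
  let t : Finset (X × Distr X) := s.sigma (fun x => (hfin x).toFinset) |>.image fun e => (e.1, e.2)
  have ht : ∀ᶠ k in (hyperfilter ℕ : Filter ℕ), ∀ e, (J k).weights e ≠ 0 → e ∈ t := by
    filter_upwards [hs, h] with k h1 h2 e he
    obtain ⟨h3, h4, -⟩ := hJ k h2
    refine Finset.mem_image.2 ⟨⟨e.1, e.2⟩, Finset.mem_sigma.2 ⟨h1 _ ?_, ?_⟩, rfl⟩
    · rw [← h4, map_ne_zero]; exact ⟨e, he, rfl⟩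
    · simpa using h3 e he
  obtain ⟨K, hK⟩ := exists_uLim ht
  refine ⟨K, fun e he => ?_, ?_, ?_⟩
  · obtain ⟨k, h1, h2⟩ := (h.and (hK.eventually_ne_zero he)).exists
    exact (hJ k h1).1 e h2
  · exact ((uLim_map Prod.fst ht hK).congr (h.mono fun k hk => (hJ k hk).2.1)).unique hm
  · exact ((uLim_mix (f := fun _ => Prod.snd) ht hK fun _ _ => uLim_const _).congr
      (h.mono fun k hk => (hJ k hk).2.2)).unique hm'

/-- The mixtures of finitely many closed convex sets form a closed set. -/
theorem uClosed_mixture {C : I → Distr X → Prop} {s : Finset I} {t : I → Finset X}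
    (hconv : ∀ i (d : Distr (Distr X)), (∀ η, d.weights η ≠ 0 → C i η) → C i (mix d id))
    (ht : ∀ i η, C i η → ∀ x, η.weights x ≠ 0 → x ∈ t i)
    (hcl : ∀ i ∈ s, UClosed (C i)) :
    UClosed fun ζ => ∃ d : Distr (I × Distr X),
      (∀ e, d.weights e ≠ 0 → e.1 ∈ s ∧ C e.1 e.2) ∧ ζ = mix d Prod.snd := by
  intro m μ h hm
  have : ∀ k, ∃ (p : Distr I) (κ : I → Distr X), (∃ d : Distr (I × Distr X),
      (∀ e, d.weights e ≠ 0 → e.1 ∈ s ∧ C e.1 e.2) ∧ m k = mix d Prod.snd) →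
      (∀ i, p.weights i ≠ 0 → i ∈ s ∧ C i (κ i)) ∧ m k = mix p κ := by
    intro k
    by_cases hk : ∃ d : Distr (I × Distr X),
      (∀ e, d.weights e ≠ 0 → e.1 ∈ s ∧ C e.1 e.2) ∧ m k = mix d Prod.snd
    · obtain ⟨d, hd, hmd⟩ := hk
      obtain ⟨K, hK⟩ := exists_eq_joint d
      -- Convexity merges all components with index `i` into one, so that only a kernel on the
      -- finite index set has to converge.
      refine ⟨d.map Prod.fst, fun i => mix (K i) id, fun _ => ⟨fun i hi => ?_, ?_⟩⟩
      · have : ∀ η, (K i).weights η ≠ 0 → i ∈ s ∧ C i η := fun η hη => hd (i, η) (by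
          rw [hK, joint_ne_zero]; exact ⟨hi, hη⟩)
        obtain ⟨η, hη⟩ := exists_weights_ne_zero (K i)
        exact ⟨(this η hη).1, hconv i _ fun η hη => (this η hη).2⟩
      · rw [hmd]
        conv_lhs => rw [hK]
        rw [mix_joint]; rfl
    · obtain ⟨k', d, -⟩ := h.exists
      exact ⟨d.map Prod.fst, fun _ => μ, fun h => (hk h).elim⟩
  choose p κ hpκ using this
  have hs : ∀ᶠ k in (hyperfilter ℕ : Filter ℕ), ∀ i, (p k).weights i ≠ 0 → i ∈ s :=
    h.mono fun k hk i hi => ((hpκ k hk).1 i hi).1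
  obtain ⟨q, hq⟩ := exists_uLim hs
  obtain ⟨g, hg1, hg2⟩ := exists_uLim_kernel hs hq
    (h.mono fun k hk i hi => ((hpκ k hk).1 i hi).2) ht hcl
  refine ⟨q.map fun i => (i, g i), fun e he => ?_, ?_⟩
  · obtain ⟨i, hi, rfl⟩ := map_ne_zero.1 he
    exact ⟨hq.support_subset hs i hi, hg1 i hi⟩
  · rw [mix_map]
    exact hm.unique (hg2.congr (h.mono fun k hk => ((hpκ k hk).2).symm))

/-- A sequence converging to `μ` consists of mixtures of `μ` with weights tending to `1`. -/
theorem ULim.exists_oplus {m : ℕ → Distr X} {μ : Distr X} (h : ULim m μ) :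
    ∃ (r : ℕ → unitInterval) (ρ : ℕ → Distr X), (∀ k, m k = oplus (r k) μ (ρ k)) ∧
      Tendsto (fun k => (r k : ℝ)) (hyperfilter ℕ : Filter ℕ) (𝓝 1) := by
  classical
  -- `δ k` bounds every relative error on the support of `μ`, so `(1 - δ k) • μ` lies below `m k`;
  -- truncation at 0 makes the factor a legitimate weight.
  let δ : ℕ → ℝ := fun k =>
    ∑ x ∈ μ.weights.support, |(m k).weights x - μ.weights x| / μ.weights x
  have hδ0 : ∀ k, 0 ≤ δ k := fun k =>
    Finset.sum_nonneg fun x _ => div_nonneg (abs_nonneg _) (μ.nonneg x)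
  have hδ : Tendsto δ (hyperfilter ℕ : Filter ℕ) (𝓝 0) := by
    have : Tendsto δ (hyperfilter ℕ : Filter ℕ)
        (𝓝 (∑ x ∈ μ.weights.support, |μ.weights x - μ.weights x| / μ.weights x)) :=
      tendsto_finsetSum _ fun x _ => (((h x).sub_const _).abs).div_const _
    simpa using this
  let r : ℕ → unitInterval := fun k =>
    ⟨max 0 (1 - δ k), le_max_left _ _, max_le zero_le_one (by linarith [hδ0 k])⟩
  have hr : Tendsto (fun k => (r k : ℝ)) (hyperfilter ℕ : Filter ℕ) (𝓝 1) := by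
    have := (tendsto_const_nhds (x := (0 : ℝ))).max ((tendsto_const_nhds (x := (1 : ℝ))).sub hδ)
    simpa using this
  have hle : ∀ k x, r k * μ.weights x ≤ (m k).weights x := by
    intro k x
    by_cases hx : μ.weights x = 0
    · rw [hx, mul_zero]; exact (m k).nonneg x
    have hpos := weights_pos hx
    change max 0 (1 - δ k) * μ.weights x ≤ _
    rcases le_total 0 (1 - δ k) with h0 | h0
    · rw [max_eq_right h0]
      have h1 : |(m k).weights x - μ.weights x| / μ.weights x ≤ δ k :=
        Finset.single_le_sum (f := fun x => |(m k).weights x - μ.weights x| / μ.weights x)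
          (fun x _ => div_nonneg (abs_nonneg _) (μ.nonneg x)) (by simpa using hx)
      rw [div_le_iff₀ hpos] at h1
      have h2 := neg_abs_le ((m k).weights x - μ.weights x)
      nlinarith
    · rw [max_eq_left h0, zero_mul]; exact (m k).nonneg x
  have hρ : ∀ k, ∃ ρ, m k = oplus (r k) μ ρ := by
    intro k
    let w : X →₀ ℝ := (m k).weights - (r k : ℝ) • μ.weights
    have hw : ∀ x, w x = (m k).weights x - r k * μ.weights x := fun x => by simp [w]
    have hw0 : 0 ≤ w := fun x => by
      rw [hw]; exact sub_nonneg.2 (hle k x)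
    have hsum : w.sum (fun _ c => c) = 1 - r k := by
      rw [Finsupp.sum_sub_index (by simp), Finsupp.sum_smul_index (by simp)]
      simp only [StdSimplex.total]
      rw [Finsupp.sum, ← Finset.mul_sum]
      have := μ.total
      rw [Finsupp.sum] at this
      rw [this, mul_one]
    -- The remainder `w` is normalized by its mass `1 - r k`. If that mass is zero, then `w`
    -- vanishes and any `ρ` will do.
    by_cases h1 : (1 : ℝ) - r k = 0
    · refine ⟨m k, distr_ext fun x => ?_⟩
      have hz : w x = 0 := by
        by_contra hx
        rw [h1, Finsupp.sum, Finset.sum_eq_zero_iff_of_nonneg fun x _ => hw0 x] at hsum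
        exact hx (hsum x (by simpa using hx))
      rw [hw] at hz
      rw [oplus_apply, h1]
      linarith
    · refine ⟨⟨(1 - r k : ℝ)⁻¹ • w, fun x => ?_, ?_⟩, distr_ext fun x => ?_⟩
      · exact mul_nonneg (inv_nonneg.2 (sub_nonneg.2 (r k).2.2)) (hw0 x)
      · rw [Finsupp.sum_smul_index (by simp), ← Finsupp.mul_sum, hsum, inv_mul_cancel₀ h1]
      · rw [oplus_apply]
        simp only [Finsupp.smul_apply, smul_eq_mul]
        rw [mul_inv_cancel_left₀ h1, hw]
        ring
  choose ρ hρ using hρ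
  exact ⟨r, ρ, hρ, hr⟩

end Limits

-- Size, finite branching and derivatives of processes

section Processes

variable {A : Type u} {τ a : A} {μ μ' ν ν' ρ : Distr (NProc A)} {I : Type*}

theorem oplus_ne_zero {X : Type*} {r : unitInterval} {μ ν : Distr X} {x : X}
    (h : (oplus r μ ν).weights x ≠ 0) : μ.weights x ≠ 0 ∨ ν.weights x ≠ 0 := by
  rw [oplus_apply] at h
  by_contra! h'
  rw [h'.1, h'.2] at h
  simp at h

theorem Denotes.unique {P : PProc A} (h : Denotes P μ) (h' : Denotes P ν) : μ = ν := by
  induction h generalizing ν with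
  | dirac E => cases h'; rfl
  | pchoice r _ _ ih₁ ih₂ =>
    cases h' with
    | pchoice _ h₁ h₂ => rw [ih₁ h₁, ih₂ h₂]

theorem Denotes.sizeOf_lt {P : PProc A} (h : Denotes P μ) :
    ∀ x, μ.weights x ≠ 0 → sizeOf x < sizeOf P := by
  induction h with
  | dirac E =>
    intro x hx
    rw [dirac_ne_zero] at hx
    subst hx
    simp
  | pchoice r _ _ ih₁ ih₂ =>
    intro x hx
    simp only [PProc.pchoice.sizeOf_spec]
    rcases oplus_ne_zero hx with hx | hx
    · have := ih₁ x hx; omega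
    · have := ih₂ x hx; omega

theorem NStep.sizeOf_lt {x : NProc A} (h : NStep x a μ) :
    ∀ y, μ.weights y ≠ 0 → sizeOf y < sizeOf x := by
  induction h with
  | pref h =>
    intro y hy
    have := h.sizeOf_lt y hy
    simp only [NProc.pref.sizeOf_spec]
    omega
  | choice_left _ ih =>
    intro y hy
    have := ih y hy
    simp only [NProc.choice.sizeOf_spec]
    omega
  | choice_right _ ih =>
    intro y hy
    have := ih y hy
    simp only [NProc.choice.sizeOf_spec]
    omega

theorem finite_nStep : ∀ x : NProc A, {η | ∃ a, NStep x a η}.Finite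
  | .nil => by
    refine Set.finite_empty.subset ?_
    rintro η ⟨a, h⟩
    cases h
  | .pref b P => by
    refine Set.Subsingleton.finite ?_
    rintro η ⟨a, h⟩ η' ⟨a', h'⟩
    cases h with
    | pref h => cases h' with
      | pref h' => exact h.unique h'
  | .choice E F => by
    refine ((finite_nStep E).union (finite_nStep F)).subset ?_
    rintro η ⟨a, h⟩
    cases h with
    | choice_left h => exact .inl ⟨a, h⟩
    | choice_right h => exact .inr ⟨a, h⟩

theorem finite_optStep (x : NProc A) : {η | OptStep τ a x η}.Finite := by
  refine ((finite_nStep x).union (Set.finite_singleton (dirac x))).subset ?_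
  rintro η (h | ⟨-, h⟩)
  · exact .inl ⟨a, h⟩
  · exact .inr h

/-- The distribution `μ` is supported on the finite set `D`. -/
def SupportedOn {X : Type*} (D : Finset X) (μ : Distr X) : Prop := ∀ x, μ.weights x ≠ 0 → x ∈ D

/-- A finite set of processes closed under derivatives. -/
def DerivativeClosed (D : Finset (NProc A)) : Prop :=
  ∀ x ∈ D, ∀ a η, NStep x a η → SupportedOn D η

theorem DerivativeClosed.biUnion [DecidableEq (NProc A)] {s : Finset I}
    {D : I → Finset (NProc A)} (h : ∀ i ∈ s, DerivativeClosed (D i)) :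
    DerivativeClosed (s.biUnion D) := by
  intro x hx a η hη y hy
  obtain ⟨i, hi, hxi⟩ := Finset.mem_biUnion.1 hx
  exact Finset.mem_biUnion.2 ⟨i, hi, h i hi x hxi a η hη y hy⟩

/-- Derivatives are smaller and finite in number, so the set is built by recursion on size. -/
theorem exists_derivativeClosed_mem (x : NProc A) : ∃ D, x ∈ D ∧ DerivativeClosed D := by
  classical
  induction hn : sizeOf x using Nat.strong_induction_on generalizing x with
  | _ n ih =>
    have ih' : ∀ y : NProc A, sizeOf y < n → ∃ D, y ∈ D ∧ DerivativeClosed D :=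
      fun y hy => ih _ hy y rfl
    choose! D hD hD' using ih'
    let s : Finset (NProc A) := (finite_nStep x).toFinset.biUnion fun η => η.weights.support
    have hs : ∀ y ∈ s, sizeOf y < n := by
      intro y hy
      obtain ⟨η, hη, hy⟩ := Finset.mem_biUnion.1 hy
      obtain ⟨a, ha⟩ := (finite_nStep x).mem_toFinset.1 hη
      exact hn ▸ ha.sizeOf_lt y (by simpa using hy)
    have hcl : DerivativeClosed (s.biUnion D) := .biUnion fun y hy => hD' y (hs y hy)
    refine ⟨insert x (s.biUnion D), Finset.mem_insert_self _ _, ?_⟩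
    intro y hy a η hη z hz
    refine Finset.mem_insert_of_mem ?_
    rcases Finset.mem_insert.1 hy with rfl | hy
    · have hzs : z ∈ s := Finset.mem_biUnion.2
        ⟨η, (finite_nStep y).mem_toFinset.2 ⟨a, hη⟩, by simpa using hz⟩
      exact Finset.mem_biUnion.2 ⟨z, hzs, hD z (hs z hzs)⟩
    · exact hcl y hy a η hη z hz

theorem exists_derivativeClosed_subset (s : Finset (NProc A)) :
    ∃ D, s ⊆ D ∧ DerivativeClosed D := by
  classical
  choose D hD hD' using exists_derivativeClosed_mem (A := A)
  exact ⟨s.biUnion D, fun x hx => Finset.mem_biUnion.2 ⟨x, hx, hD x⟩, .biUnion fun x _ => hD' x⟩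

theorem exists_derivativeClosed (μ : Distr (NProc A)) :
    ∃ D, SupportedOn D μ ∧ DerivativeClosed D := by
  obtain ⟨D, h, h'⟩ := exists_derivativeClosed_subset μ.weights.support
  exact ⟨D, fun x hx => h (by simpa using hx), h'⟩

variable {D : Finset (NProc A)}

theorem DerivativeClosed.partialStep (hD : DerivativeClosed D) (hμ : SupportedOn D μ)
    (h : PartialStep τ μ a μ') : SupportedOn D μ' := by
  rw [partialStep_iff_lift] at h
  obtain ⟨J, hJ, rfl, rfl⟩ := h
  intro y hy
  obtain ⟨e, he, hey⟩ := mix_ne_zero.1 hy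
  have hx : e.1 ∈ D := hμ _ (map_ne_zero.2 ⟨e, he, rfl⟩)
  rcases hJ e he with h | ⟨-, h⟩
  · exact hD _ hx _ _ h y hey
  · rw [h, dirac_ne_zero] at hey
    rwa [hey]

theorem DerivativeClosed.weakStep (hD : DerivativeClosed D) (hμ : SupportedOn D μ)
    (h : WeakStep τ μ μ') : SupportedOn D μ' := by
  induction h with
  | refl => exact hμ
  | tail _ h ih => exact hD.partialStep ih h

theorem SupportedOn.of_mix {X : Type*} {D : Finset X} {p : Distr I} {m : I → Distr X}
    (h : SupportedOn D (mix p m)) {i : I} (hi : p.weights i ≠ 0) : SupportedOn D (m i) :=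
  fun x hx => h x (mix_ne_zero.2 ⟨i, hi, hx⟩)

-- Transitions are closed under limits

theorem partialStep_uLim {m m' : ℕ → Distr (NProc A)}
    (hs : ∀ᶠ k in (hyperfilter ℕ : Filter ℕ), SupportedOn D (m k))
    (h : ∀ᶠ k in (hyperfilter ℕ : Filter ℕ), PartialStep τ (m k) a (m' k))
    (hm : ULim m μ) (hm' : ULim m' μ') : PartialStep τ μ a μ' :=
  partialStep_iff_lift.2 (lift_uLim finite_optStep hs
    (h.mono fun _ hk => partialStep_iff_lift.1 hk) hm hm')

/-- Weak moves decompose over the points of the support, which reduces closedness to Dirac sources.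
It is a hypothesis on `D` only, so that the lemma can serve inside the induction proving it. -/
theorem weakStep_uLim_of_uClosed {m m' : ℕ → Distr (NProc A)}
    (hcl : ∀ x ∈ D, UClosed fun ζ => WeakStep τ (dirac x) ζ)
    (hs : ∀ᶠ k in (hyperfilter ℕ : Filter ℕ), SupportedOn D (m k))
    (h : ∀ᶠ k in (hyperfilter ℕ : Filter ℕ), WeakStep τ (m k) (m' k))
    (hm : ULim m μ) (hm' : ULim m' μ') : WeakStep τ μ μ' := by
  have hker : ∀ k, WeakStep τ (m k) (m' k) → ∃ κ : NProc A → Distr (NProc A),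
      m' k = mix (m k) κ ∧ ∀ x, (m k).weights x ≠ 0 → WeakStep τ (dirac x) (κ x) := by
    intro k hk
    rw [← mix_dirac (m k)] at hk
    exact weakStep_decompose hk
  choose! κ hκ1 hκ2 using hker
  choose t ht ht' using exists_derivativeClosed_mem (A := A)
  obtain ⟨g, hg1, hg2⟩ := exists_uLim_kernel (C := fun x ζ => WeakStep τ (dirac x) ζ) (t := t)
    hs hm (h.mono fun k hk => hκ2 k hk) (fun x η hη => (ht' x).weakStep (fun y hy => by
      rw [dirac_ne_zero] at hy
      exact hy ▸ ht x) hη) hcl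
  rw [hm'.unique (hg2.congr (h.mono fun k hk => (hκ1 k hk).symm)), ← mix_dirac μ, mix_mix]
  simp only [mix_dirac_left]
  exact weakStep_mix hg1

/-- Induction on size. Sorted by first proper step, what `x` reaches is a mixture of resting mass
and of weak derivatives of its finitely many successors. These live on smaller processes, so each of
the finitely many sets is closed, and `uClosed_mixture` applies. -/
theorem uClosed_weakStep_dirac (τ : A) (x : NProc A) :
    UClosed fun ζ => WeakStep τ (dirac x) ζ := by
  classical
  induction hn : sizeOf x using Nat.strong_induction_on generalizing x with
  | _ n ih =>
    obtain ⟨D, hxD, hD⟩ := exists_derivativeClosed_mem x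
    let C : Option (Distr (NProc A)) → Distr (NProc A) → Prop := fun o ξ =>
      (o = none → ξ = dirac x) ∧ ∀ η, o = some η → NStep x τ η ∧ WeakStep τ η ξ
    let s : Finset (Option (Distr (NProc A))) :=
      insert none ((finite_nStep x).toFinset.image some)
    have hδ : SupportedOn D (dirac x) := fun y hy => by
      rw [dirac_ne_zero] at hy; exact hy ▸ hxD
    have hconv : ∀ i (d : Distr (Distr (NProc A))), (∀ η, d.weights η ≠ 0 → C i η) →
        C i (mix d id) := by
      intro i d hd
      refine ⟨fun hi => ?_, fun η hi => ?_⟩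
      · rw [mix_congr (f := id) (g := fun _ => dirac x) fun η hη => (hd η hη).1 hi, mix_const]
      · obtain ⟨ξ, hξ⟩ := exists_weights_ne_zero d
        refine ⟨((hd ξ hξ).2 η hi).1, ?_⟩
        rw [← mix_const d η]
        exact weakStep_mix fun ξ hξ => ((hd ξ hξ).2 η hi).2
    have hsupp : ∀ i η, C i η → SupportedOn D η := by
      rintro (_ | η) ξ h
      · rw [h.1 rfl]; exact hδ
      · exact hD.weakStep (hD x hxD τ η (h.2 η rfl).1) (h.2 η rfl).2
    have hcl : ∀ i ∈ s, UClosed (C i) := by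
      rintro (_ | η) - m μ hm hlim
      · refine ⟨fun _ => hlim.unique ((uLim_const _).congr (hm.mono fun k hk => (hk.1 rfl).symm)),
          by simp⟩
      · refine ⟨by simp, ?_⟩
        rintro _ ⟨⟩
        obtain ⟨k, hk⟩ := hm.exists
        have hstep := (hk.2 η rfl).1
        refine ⟨hstep, ?_⟩
        refine weakStep_uLim_of_uClosed (D := η.weights.support) (m := fun _ => η) (fun y hy => ?_)
          (.of_forall fun _ y hy => by simpa using hy)
          (hm.mono fun k hk => (hk.2 η rfl).2) (uLim_const η) hlim
        exact ih _ (hn ▸ hstep.sizeOf_lt y (by simpa using hy)) y rfl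
    have hmain := uClosed_mixture (s := s) (t := fun _ => D) hconv hsupp hcl
    intro m μ hm hlim
    have hopt : OptStep τ τ = fun y η => NStep y τ η ∨ η = dirac y := by
      funext y η
      simp [OptStep]
    obtain ⟨d, hd, rfl⟩ := hmain m μ (hm.mono fun k hk => by
      rw [weakStep_eq, hopt] at hk
      obtain ⟨d, h1, h2⟩ := reflTransGen_lift_dirac hk
      refine ⟨d, ?_, h1⟩
      rintro ⟨_ | η, ξ⟩ he
      · exact ⟨by simp [s], fun _ => (h2 _ he).1 ξ rfl, by simp⟩
      · have h3 := (h2 _ he).2 η ξ rfl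
        refine ⟨?_, by simp, ?_⟩
        · simp only [s, Finset.mem_insert, reduceCtorEq, false_or]
          exact Finset.mem_image_of_mem _ ((finite_nStep x).mem_toFinset.2 ⟨τ, h3.1⟩)
        · rintro _ ⟨⟩
          rw [weakStep_eq, hopt]
          exact h3) hlim
    -- Writing the source as a mixture of copies of itself lets every component follow its own path.
    rw [← mix_const d (dirac x)]
    refine weakStep_mix ?_
    rintro ⟨_ | η, ξ⟩ he
    · rw [(hd _ he).2.1 rfl]; exact .refl
    · obtain ⟨h1, h2⟩ := (hd _ he).2.2 η rfl
      refine Relation.ReflTransGen.head (.inl (dStep_iff_lift.2 ?_)) h2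
      have := lift_map (p := dirac ()) (S := fun x η => NStep x τ η) (f := fun _ => x)
        (η := fun _ => η) fun _ _ => h1
      simpa only [mix_const, map_const] using this

theorem weakStep_uLim {m m' : ℕ → Distr (NProc A)}
    (hs : ∀ᶠ k in (hyperfilter ℕ : Filter ℕ), SupportedOn D (m k))
    (h : ∀ᶠ k in (hyperfilter ℕ : Filter ℕ), WeakStep τ (m k) (m' k))
    (hm : ULim m μ) (hm' : ULim m' μ') : WeakStep τ μ μ' :=
  weakStep_uLim_of_uClosed (fun x _ => uClosed_weakStep_dirac τ x) hs h hm hm'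

-- Bisimilarity is closed under limits

/-- The closure of bisimilarity under limits of distributions with uniformly finite support. -/
def LimBisimilar (τ : A) (μ ν : Distr (NProc A)) : Prop :=
  ∃ (D : Finset (NProc A)) (m n : ℕ → Distr (NProc A)), DerivativeClosed D ∧ ULim m μ ∧
    ULim n ν ∧ ∀ᶠ k in (hyperfilter ℕ : Filter ℕ),
      SupportedOn D (m k) ∧ SupportedOn D (n k) ∧ Bisimilar τ (m k) (n k)

/-- This makes the left-hand sequence constant, so that challenges of `μ` itself can be answered.
Write `m k` as `μ ⊕_{r k} ρ k` with `r k` tending to 1. Decomposition moves `n k` to a mixture whose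
first component is bisimilar to `μ`; the second loses its weight, so the mixture and its first
component have the same limit `ν'`. -/
theorem LimBisimilar.exists_weakStep (h : LimBisimilar τ μ ν) :
    ∃ (D : Finset (NProc A)) (n : ℕ → Distr (NProc A)) (ν' : Distr (NProc A)),
      DerivativeClosed D ∧ SupportedOn D μ ∧ WeakStep τ ν ν' ∧ ULim n ν' ∧
      ∀ᶠ k in (hyperfilter ℕ : Filter ℕ), SupportedOn D (n k) ∧ Bisimilar τ μ (n k) := by
  obtain ⟨D, m, n, hD, hm, hn, hev⟩ := h
  have hμD : SupportedOn D μ := hm.support_subset (hev.mono fun k hk => hk.1)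
  obtain ⟨r, ρ, hmr, hr⟩ := hm.exists_oplus
  choose p hp0 hp1 hp using oplus_eq_mix
  have hdec : ∀ k, Bisimilar τ (m k) (n k) → ∃ s : Fin 2 → Distr (NProc A),
      WeakStep τ (n k) (mix (p (r k)) s) ∧ ((r k : ℝ) ≠ 0 → Bisimilar τ μ (s 0)) := by
    intro k hk
    rw [hmr k, show oplus (r k) μ (ρ k) = mix (p (r k)) ![μ, ρ k] from hp _ _ ![μ, ρ k]] at hk
    obtain ⟨s, h1, -, h3⟩ := hk.decompose
    exact ⟨s, h1, fun h0 => h3 0 (by rwa [hp0])⟩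
  choose! s hs1 hs2 using hdec
  have hr0 : ∀ᶠ k in (hyperfilter ℕ : Filter ℕ), (r k : ℝ) ≠ 0 := hr.eventually_ne one_ne_zero
  have hsupp : ∀ᶠ k in (hyperfilter ℕ : Filter ℕ), SupportedOn D (s k 0) := by
    filter_upwards [hev, hr0] with k h1 h2
    exact (hD.weakStep h1.2.1 (hs1 k h1.2.2)).of_mix (by rwa [hp0])
  obtain ⟨ν', hν'⟩ := exists_uLim hsupp
  have hplim : ULim (fun k => p (r k)) (dirac 0) := by
    intro i
    fin_cases i
    · simpa [hp0, dirac_apply] using hr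
    · have := (tendsto_const_nhds (x := (1 : ℝ))).sub hr
      simpa [hp1, dirac_apply] using this
  have hmix : ULim (fun k => mix (p (r k)) (s k)) ν' := by
    have := uLim_mix (p := fun k => p (r k)) (f := s) (g := fun _ => ν') (s := Finset.univ)
      (by simp) hplim (fun i hi => by
        rw [dirac_ne_zero] at hi
        subst hi
        exact hν')
    rwa [mix_dirac_left] at this
  refine ⟨D, fun k => s k 0, ν', hD, hμD, ?_, hν', ?_⟩
  · exact weakStep_uLim (hev.mono fun k hk => hk.2.1) (hev.mono fun k hk => hs1 k hk.2.2) hn hmix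
  · filter_upwards [hev, hr0, hsupp] with k h1 h2 h3
    exact ⟨h3, hs2 k h1.2.2 h2⟩

theorem limBisimilar_isBranchingBisimulation (τ : A) :
    IsBranchingBisimulation τ (LimBisimilar τ) := by
  classical
  refine ⟨⟨?_, ?_⟩, ?_⟩
  · rintro μ ν ⟨D, m, n, hD, hm, hn, hev⟩
    exact ⟨D, n, m, hD, hn, hm, hev.mono fun k hk => ⟨hk.2.1, hk.1, hk.2.2.symm⟩⟩
  · rintro μ ν h N p m rfl
    obtain ⟨D, n, ν₁, hD, hμD, hνν₁, hn, hev⟩ := h.exists_weakStep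
    rw [bigOplus_eq_mix] at *
    have hdec : ∀ k, Bisimilar τ (mix p m) (n k) → ∃ s : Fin N → Distr (NProc A),
        WeakStep τ (n k) (mix p s) ∧ Bisimilar τ (mix p m) (mix p s) ∧
        ∀ i, p.weights i ≠ 0 → Bisimilar τ (m i) (s i) := fun k hk => hk.decompose
    choose! s hs1 hs2 hs3 using hdec
    have hsD : ∀ᶠ k in (hyperfilter ℕ : Filter ℕ), SupportedOn D (mix p (s k)) :=
      hev.mono fun k hk => hD.weakStep hk.1 (hs1 k hk.2)
    have hlim : ∀ i, ∃ η, (p.weights i ≠ 0 → ULim (fun k => s k i) η) ∧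
        (p.weights i = 0 → η = m i) := by
      intro i
      by_cases hi : p.weights i = 0
      · exact ⟨m i, fun h => (h hi).elim, fun _ => rfl⟩
      · obtain ⟨η, hη⟩ := exists_uLim (hsD.mono fun k hk => hk.of_mix hi)
        exact ⟨η, fun _ => hη, fun h => (hi h).elim⟩
    choose g hg hg' using hlim
    have hmix : ULim (fun k => mix p (s k)) (mix p g) :=
      uLim_mix (s := Finset.univ) (by simp) (uLim_const p) hg
    refine ⟨mix p g, g, hνν₁.trans ?_, ?_, (bigOplus_eq_mix _ _).symm, fun i => ?_⟩
    · exact weakStep_uLim (hev.mono fun k hk => hk.1) (hev.mono fun k hk => hs1 k hk.2) hn hmix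
    · refine ⟨D, fun _ => mix p m, _, hD, uLim_const _, hmix, ?_⟩
      filter_upwards [hev, hsD] with k h1 h2
      exact ⟨hμD, h2, hs2 k h1.2⟩
    · by_cases hi : p.weights i = 0
      · rw [hg' i hi]
        obtain ⟨D', h1, h2⟩ := exists_derivativeClosed (m i)
        exact ⟨D', fun _ => m i, fun _ => m i, h2, uLim_const _, uLim_const _,
          .of_forall fun _ => ⟨h1, h1, bisimilar_refl _⟩⟩
      · refine ⟨D, fun _ => m i, _, hD, uLim_const _, hg i hi, ?_⟩
        filter_upwards [hev, hsD] with k h1 h2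
        exact ⟨hμD.of_mix hi, h2.of_mix hi, hs3 k h1.2 i hi⟩
  · rintro μ ν h a μ' hs
    obtain ⟨D, n, ν₁, hD, hμD, hνν₁, hn, hev⟩ := h.exists_weakStep
    have hstep : ∀ k, Bisimilar τ μ (n k) → ∃ ν₂ ν', WeakStep τ (n k) ν₂ ∧
        PartialStep τ ν₂ a ν' ∧ Bisimilar τ μ ν₂ ∧ Bisimilar τ μ' ν' := fun k hk => hk.dStep hs
    choose! s s' h1 h2 h3 h4 using hstep
    have hsD : ∀ᶠ k in (hyperfilter ℕ : Filter ℕ), SupportedOn D (s k) :=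
      hev.mono fun k hk => hD.weakStep hk.1 (h1 k hk.2)
    have hsD' : ∀ᶠ k in (hyperfilter ℕ : Filter ℕ), SupportedOn D (s' k) := by
      filter_upwards [hev, hsD] with k hk hk'
      exact hD.partialStep hk' (h2 k hk.2)
    obtain ⟨ν₂, hν₂⟩ := exists_uLim hsD
    obtain ⟨ν', hν'⟩ := exists_uLim hsD'
    refine ⟨ν₂, ν', hνν₁.trans (weakStep_uLim (hev.mono fun k hk => hk.1)
      (hev.mono fun k hk => h1 k hk.2) hn hν₂),
      partialStep_uLim hsD (hev.mono fun k hk => h2 k hk.2) hν₂ hν',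
      ⟨D, fun _ => μ, s, hD, uLim_const _, hν₂, ?_⟩, D, fun _ => μ', s', hD, uLim_const _, hν', ?_⟩
    · filter_upwards [hev, hsD] with k hk hk'
      exact ⟨hμD, hk', h3 k hk.2⟩
    · filter_upwards [hev, hsD'] with k hk hk'
      exact ⟨hD.partialStep hμD (τ := τ) (.inl hs), hk', h4 k hk.2⟩

/-- Bisimilarity is preserved by limits of distributions with uniformly finite support. -/
theorem bisimilar_uLim {n : ℕ → Distr (NProc A)} (hD : DerivativeClosed D) (hμ : SupportedOn D μ)
    (hn : ULim n ν) (h : ∀ᶠ k in (hyperfilter ℕ : Filter ℕ),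
      SupportedOn D (n k) ∧ Bisimilar τ μ (n k)) : Bisimilar τ μ ν :=
  ⟨_, limBisimilar_isBranchingBisimulation τ, D, fun _ => μ, n, hD, uLim_const μ, hn,
    h.mono fun _ hk => ⟨hμ, hk.1, hk.2⟩⟩

end Processes

-- Stable distributions

section Stability

variable {A : Type u} {τ a : A} {μ μ' ν ν' ρ σ : Distr (NProc A)} {I : Type*}
  {D : Finset (NProc A)}

/-- The expected size of a process drawn from a distribution. -/
def weight (μ : Distr (NProc A)) : ℝ := ∑ x ∈ μ.weights.support, μ.weights x * (sizeOf x : ℝ)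

theorem SupportedOn.weight_eq (h : SupportedOn D μ) :
    weight μ = ∑ x ∈ D, μ.weights x * (sizeOf x : ℝ) :=
  Finset.sum_subset (fun x hx => h x (by simpa using hx)) fun x _ hx => by
    rw [Finsupp.notMem_support_iff.1 hx, zero_mul]

theorem weight_nonneg (μ : Distr (NProc A)) : 0 ≤ weight μ :=
  Finset.sum_nonneg fun x _ => mul_nonneg (μ.nonneg x) (Nat.cast_nonneg _)

theorem weight_dirac (x : NProc A) : weight (dirac x) = sizeOf x := by
  classical
  rw [SupportedOn.weight_eq (D := {x}) fun y hy => by simpa [dirac_ne_zero] using hy]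
  simp [dirac_apply]

theorem weight_mix (p : Distr I) (f : I → Distr (NProc A)) :
    weight (mix p f) = ∑ i ∈ p.weights.support, p.weights i * weight (f i) := by
  classical
  have hf : ∀ i ∈ p.weights.support,
      SupportedOn (p.weights.support.biUnion fun i => (f i).weights.support) (f i) :=
    fun i hi x hx => Finset.mem_biUnion.2 ⟨i, hi, by simpa using hx⟩
  have hp : SupportedOn (p.weights.support.biUnion fun i => (f i).weights.support) (mix p f) := by
    intro x hx
    obtain ⟨i, hi, hix⟩ := mix_ne_zero.1 hx
    exact hf i (by simpa using hi) x hix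
  rw [hp.weight_eq]
  simp only [mix_apply, Finset.sum_mul]
  rw [Finset.sum_comm]
  refine Finset.sum_congr rfl fun i hi => ?_
  rw [(hf i hi).weight_eq, Finset.mul_sum]
  exact Finset.sum_congr rfl fun x _ => mul_assoc _ _ _

theorem weight_mix_lt {p : Distr I} {f g : I → Distr (NProc A)}
    (h : ∀ i, p.weights i ≠ 0 → weight (f i) ≤ weight (g i)) {i : I} (hi : p.weights i ≠ 0)
    (hlt : weight (f i) < weight (g i)) : weight (mix p f) < weight (mix p g) := by
  rw [weight_mix, weight_mix]
  refine Finset.sum_lt_sum (fun j hj => ?_) ⟨i, by simpa using hi, ?_⟩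
  · exact mul_le_mul_of_nonneg_left (h j (by simpa using hj)) (p.nonneg j)
  · exact mul_lt_mul_of_pos_left hlt (weights_pos hi)

theorem uLim_weight {n : ℕ → Distr (NProc A)}
    (hs : ∀ᶠ k in (hyperfilter ℕ : Filter ℕ), SupportedOn D (n k)) (hn : ULim n ν) :
    Tendsto (fun k => weight (n k)) (hyperfilter ℕ : Filter ℕ) (𝓝 (weight ν)) := by
  rw [SupportedOn.weight_eq (hn.support_subset hs)]
  refine (tendsto_finsetSum D fun x _ => (hn x).mul_const _).congr' ?_
  exact hs.mono fun k hk => hk.weight_eq.symm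

theorem NStep.weight_lt {x : NProc A} (h : NStep x a μ) : weight μ < sizeOf x := by
  rw [← weight_dirac, ← mix_const μ (dirac x), ← mix_dirac μ, mix_mix]
  simp only [mix_dirac_left]
  have hlt : ∀ y, μ.weights y ≠ 0 → weight (dirac y) < weight (dirac x) := fun y hy => by
    rw [weight_dirac, weight_dirac]; exact_mod_cast h.sizeOf_lt y hy
  obtain ⟨y, hy⟩ := exists_weights_ne_zero μ
  exact weight_mix_lt (fun y hy => (hlt y hy).le) hy (hlt y hy)

/-- Idle pieces keep their weight and moving pieces lose some, so equality of weights forces every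
piece to idle. -/
theorem PartialStep.eq_or_weight_lt (h : PartialStep τ μ a μ') : μ' = μ ∨ weight μ' < weight μ := by
  rw [partialStep_iff_lift] at h
  obtain ⟨J, hJ, rfl, rfl⟩ := h
  rw [← mix_dirac_comp]
  have hle : ∀ e, J.weights e ≠ 0 → e.2 = dirac e.1 ∨ weight e.2 < weight (dirac e.1) := by
    intro e he
    rcases hJ e he with h | ⟨-, h⟩
    · right; rw [weight_dirac]; exact h.weight_lt
    · exact .inl h
  by_cases h : ∀ e, J.weights e ≠ 0 → e.2 = dirac e.1
  · exact .inl (mix_congr h)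
  · push Not at h
    obtain ⟨e, he, hne⟩ := h
    refine .inr (weight_mix_lt (fun e he => ?_) he ((hle e he).resolve_left hne))
    rcases hle e he with h | h
    · rw [h]
    · exact h.le

theorem weakStep_eq_or_weight_lt (h : WeakStep τ μ μ') : μ' = μ ∨ weight μ' < weight μ := by
  induction h with
  | refl => exact .inl rfl
  | tail _ hbc ih =>
    rcases hbc.eq_or_weight_lt with rfl | h
    · exact ih
    · rcases ih with rfl | h'
      · exact .inr h
      · exact .inr (h.trans h')

/-- A distribution that cannot move to a different bisimilar distribution by internal steps. -/
def Stable (τ : A) (σ : Distr (NProc A)) : Prop :=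
  ∀ σ', WeakStep τ σ σ' → Bisimilar τ σ σ' → σ' = σ

/-- Every distribution unfolds to a bisimilar stable distribution. -/
theorem exists_stable (τ : A) (μ : Distr (NProc A)) :
    ∃ σ, WeakStep τ μ σ ∧ Bisimilar τ μ σ ∧ Stable τ σ := by
  -- The infimum of `T` is attained at a limit of a minimizing sequence, since both conditions on
  -- `ζ` are closed; a minimizer has no room for a further nontrivial move.
  let T : Set ℝ := weight '' {ζ | WeakStep τ μ ζ ∧ Bisimilar τ μ ζ}
  have hne : T.Nonempty := ⟨_, μ, ⟨.refl, bisimilar_refl μ⟩, rfl⟩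
  have hbdd : BddBelow T := ⟨0, by rintro _ ⟨ζ, -, rfl⟩; exact weight_nonneg ζ⟩
  obtain ⟨u, -, hu, hT⟩ := exists_seq_tendsto_sInf hne hbdd
  choose ζ hζ hw using hT
  obtain ⟨D, hμ, hD⟩ := exists_derivativeClosed μ
  have hs : ∀ k, SupportedOn D (ζ k) := fun k => hD.weakStep hμ (hζ k).1
  obtain ⟨σ, hσ⟩ := exists_uLim (.of_forall hs)
  have hweight : weight σ = sInf T := by
    refine tendsto_nhds_unique (uLim_weight (.of_forall hs) hσ) ?_
    simp only [hw]
    exact hu.mono_left Nat.hyperfilter_le_atTop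
  have h1 : WeakStep τ μ σ := weakStep_uLim (m := fun _ => μ) (.of_forall fun _ => hμ)
    (.of_forall fun k => (hζ k).1) (uLim_const μ) hσ
  have h2 : Bisimilar τ μ σ := bisimilar_uLim hD hμ hσ (.of_forall fun k => ⟨hs k, (hζ k).2⟩)
  refine ⟨σ, h1, h2, fun σ' h3 h4 => (weakStep_eq_or_weight_lt h3).resolve_right ?_⟩
  rw [not_lt, hweight]
  exact csInf_le hbdd ⟨σ', ⟨h1.trans h3, h2.trans h4⟩, rfl⟩

/-- A nontrivial bisimilar move of one component would give a bisimilar weak move of the whole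
mixture that strictly lowers its weight. -/
theorem Stable.of_mix {p : Distr I} {f : I → Distr (NProc A)} (h : Stable τ (mix p f)) {i : I}
    (hi : p.weights i ≠ 0) : Stable τ (f i) := by
  classical
  intro σ' h1 h2
  have heq := h (mix p (Function.update f i σ'))
    (weakStep_mix fun j _ => by
      by_cases hj : j = i
      · subst hj; simpa using h1
      · simpa [hj] using weakStep_refl)
    (bisimilar_mix fun j _ => by
      by_cases hj : j = i
      · subst hj; simpa using h2
      · simpa [hj] using bisimilar_refl _)
  refine (weakStep_eq_or_weight_lt h1).resolve_right fun hlt => ?_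
  refine (weight_mix_lt (g := f) (f := Function.update f i σ') (fun j _ => ?_) hi
    (by simpa using hlt)).ne (by rw [heq])
  by_cases hj : j = i
  · subst hj; simpa using hlt.le
  · simp [hj]

theorem Stable.dirac_of_ne_zero (h : Stable τ σ) {x : NProc A} (hx : σ.weights x ≠ 0) :
    Stable τ (dirac x) := by
  rw [← mix_dirac σ] at h
  exact h.of_mix hx

-- Distributions over bisimilarity classes

/-- Bisimilarity of processes. -/
def procSetoid (τ : A) : Setoid (NProc A) where
  r x y := Bisimilar τ (dirac x) (dirac y)
  iseqv := ⟨fun _ => bisimilar_refl _, fun h => h.symm, fun h h' => h.trans h'⟩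

/-- The distribution over bisimilarity classes of processes induced by a distribution. -/
def classDistr (τ : A) (μ : Distr (NProc A)) : Distr (Quotient (procSetoid τ)) :=
  μ.map (Quotient.mk (procSetoid τ))

theorem bisimilar_of_classDistr_eq (h : classDistr τ μ = classDistr τ ν) : Bisimilar τ μ ν := by
  have key : ∀ μ : Distr (NProc A), Bisimilar τ μ ((classDistr τ μ).map Quotient.out) := by
    intro μ
    have h1 : (classDistr τ μ).map Quotient.out =
        mix μ fun x => dirac (Quotient.out (Quotient.mk (procSetoid τ) x)) := by
      rw [classDistr, StdSimplex.map_map, mix_dirac_comp]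
    rw [h1]
    conv_lhs => rw [← mix_dirac μ]
    exact bisimilar_mix fun x _ =>
      (Quotient.exact (Quotient.out_eq (Quotient.mk (procSetoid τ) x))).symm
  refine (key μ).trans ?_
  rw [h]
  exact (key ν).symm

/-- Splitting `σ` into points makes `ρ` move to a matching mixture of some `n x`, which is `ρ`
itself by stability. Splitting `n x` into points in turn makes `dirac x` move, and its stability
forces all matches to be `dirac x`. Hence every process in the support of `n x` lies in the class of
`x`. -/
theorem classDistr_eq_of_stable (hσ : ∀ x, σ.weights x ≠ 0 → Stable τ (dirac x))
    (hρ : Stable τ ρ) (h : Bisimilar τ σ ρ) : classDistr τ σ = classDistr τ ρ := by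
  rw [← mix_dirac σ] at h
  obtain ⟨n, h1, h2, h3⟩ := h.decompose
  have heq : mix σ n = ρ := hρ _ h1 (h.symm.trans h2)
  have hclass : ∀ x, σ.weights x ≠ 0 → ∀ y, (n x).weights y ≠ 0 →
      Bisimilar τ (dirac x) (dirac y) := by
    intro x hx y hy
    have h4 := (h3 x hx).symm
    rw [← mix_dirac (n x)] at h4
    obtain ⟨ξ, h5, h6, h7⟩ := h4.decompose
    have h8 := hσ x hx _ h5 (h4.symm.trans h6)
    have := h7 y hy
    rw [eq_dirac_of_mix_eq_dirac h8 hy] at this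
    exact this.symm
  rw [← heq, classDistr, classDistr, map_mix, ← mix_dirac_comp]
  refine mix_congr fun x hx => ?_
  rw [← mix_dirac_comp, mix_congr (g := fun _ => dirac (Quotient.mk (procSetoid τ) x))
    fun y hy => by rw [Quotient.sound (s := procSetoid τ) (hclass x hx y hy).symm], mix_const]

/-- Stability of the support points passes directly to convex combinations, hence the hypotheses in
this form. Both sides are compared with one stable distribution bisimilar to them. -/
theorem classDistr_eq (hσ : ∀ x, σ.weights x ≠ 0 → Stable τ (dirac x))
    (hρ : ∀ x, ρ.weights x ≠ 0 → Stable τ (dirac x)) (h : Bisimilar τ σ ρ) :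
    classDistr τ σ = classDistr τ ρ := by
  obtain ⟨ζ, -, h1, h2⟩ := exists_stable τ σ
  exact (classDistr_eq_of_stable hσ h2 h1).trans
    (classDistr_eq_of_stable hρ h2 (h.symm.trans h1)).symm

theorem bisimilar_oplus (r : unitInterval) (h : Bisimilar τ μ μ') (h' : Bisimilar τ ν ν') :
    Bisimilar τ (oplus r μ ν) (oplus r μ' ν') := by
  obtain ⟨p, -, -, hp⟩ := oplus_eq_mix r
  rw [show oplus r μ ν = mix p ![μ, ν] from hp _ ![μ, ν],
    show oplus r μ' ν' = mix p ![μ', ν'] from hp _ ![μ', ν']]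
  refine bisimilar_mix fun i _ => ?_
  fin_cases i
  · exact h
  · exact h'

theorem classDistr_oplus (r : unitInterval) :
    classDistr τ (oplus r μ ν) = oplus r (classDistr τ μ) (classDistr τ ν) := by
  obtain ⟨p, -, -, hp⟩ := oplus_eq_mix r
  rw [show oplus r μ ν = mix p ![μ, ν] from hp _ ![μ, ν],
    show oplus r (classDistr τ μ) (classDistr τ ν) = mix p ![classDistr τ μ, classDistr τ ν] from
      hp _ ![classDistr τ μ, classDistr τ ν], classDistr, map_mix]
  refine mix_congr fun i _ => ?_
  fin_cases i <;> rfl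

end Stability

end

end ProbProc

-- Cancellation

theorem mainTheorem1 {A : Type*} (τ : A)
    (μ μ' ν ν' : ProbProc.Distr (ProbProc.NProc A)) (r : unitInterval) (hr : 0 < r)
    (h : ProbProc.Bisimilar τ (ProbProc.oplus r μ ν) (ProbProc.oplus r μ' ν'))
    (hν : ProbProc.Bisimilar τ ν ν') :
    ProbProc.Bisimilar τ μ μ' := by
  obtain ⟨σ, -, hσ, sσ⟩ := ProbProc.exists_stable τ μ
  obtain ⟨σ', -, hσ', sσ'⟩ := ProbProc.exists_stable τ μ'
  obtain ⟨ρ, -, hρ, sρ⟩ := ProbProc.exists_stable τ ν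
  obtain ⟨ρ', -, hρ', sρ'⟩ := ProbProc.exists_stable τ ν'
  have hstable : ∀ {α β : ProbProc.Distr (ProbProc.NProc A)}, ProbProc.Stable τ α →
      ProbProc.Stable τ β → ∀ x, (ProbProc.oplus r α β).weights x ≠ 0 →
      ProbProc.Stable τ (ProbProc.dirac x) := fun hα hβ x hx =>
    (ProbProc.oplus_ne_zero hx).elim hα.dirac_of_ne_zero hβ.dirac_of_ne_zero
  have h1 := ProbProc.classDistr_eq (hstable sσ sρ) (hstable sσ' sρ')
    (((ProbProc.bisimilar_oplus r hσ hρ).symm.trans h).trans (ProbProc.bisimilar_oplus r hσ' hρ'))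
  have h2 := ProbProc.classDistr_eq (fun _ => sρ.dirac_of_ne_zero) (fun _ => sρ'.dirac_of_ne_zero)
    ((hρ.symm.trans hν).trans hρ')
  rw [ProbProc.classDistr_oplus, ProbProc.classDistr_oplus, h2] at h1
  -- At each class the two combinations now share the summand from `ρ'`; subtracting it and dividing
  -- by `r` leaves equal class weights for `σ` and `σ'`.
  refine (hσ.trans (ProbProc.bisimilar_of_classDistr_eq (ProbProc.distr_ext fun c => ?_))).trans
    hσ'.symm
  have h3 := ProbProc.oplus_apply r (ProbProc.classDistr τ σ) (ProbProc.classDistr τ ρ') c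
  rw [h1, ProbProc.oplus_apply] at h3
  have hr' : (r : ℝ) ≠ 0 := ne_of_gt (show (0 : ℝ) < r from hr)
  exact (mul_left_cancel₀ hr' (add_right_cancel h3)).symm
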